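/- Let $\mathbb F_p^{\mathbb N}$ ($p$ prime) be the space of finitely supported sequences $(x_i)_{i\in\mathbb N}$ over $\mathbb F_p=\{0,1,\dots,p-1\}$, with Hamming distance $d(x,y)=|\{i: x_i\ne y_i\}|$ and standard basis $E=(e_0,e_1,\dots)$. For distinct $\xi,\eta\in\mathbb N$, let $F(\xi,\eta)$ be the basis obtained from $E$ by replacing $e_\xi$ with $e_\xi+e_\eta$. A basis $F=(f_i)_{i\in\mathbb N}$ orders $\mathbb F_p^{\mathbb N}$: for $x\neq y$, $x<_F y$ if at the largest index at which the $F$-coordinates of $x$ and $y$ differ, that of $x$ is the smaller one. For $d\ge 2$ define recursively, for $a\in\mathbb N$: $w(a)$ is the $<_F$-minimum of all $z$ with $d(z,w(b))\ge d$ for $0\le b<a$. Define also $w^-(a)$: if $a$ is a power of $p$ (including $p^0=1$), it is the $<_F$-minimum of all $z$ with $d(z,w^-(b))\ge d$ for $0\le b<a$; otherwise $w^-(a)=\sum_i a_i\,w^-(p^i)$, where $a=\sum_i a_ip^i$ is the base-$p$ expansion of $a$. For $k\ge 1$ let $\mathrm{Lex}=\{w(a):0\le a<p^k\}$ and $\mathrm{Lex}^-=\{w^-(a):0\le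 a<p^k\}$. **Theorem.** Let $p=3$, $k\ge 1$, $d'\ge 2$, $d=3^{k-1}d'$, and let $F$ be $E$ or some $F(\xi,\eta)$ with $\xi\ne\eta$. Then $\mathrm{Lex}$ has exactly $3^k$ elements and is linear, i.e. is a linear subspace of $\mathbb F_3^{\mathbb N}$. Moreover $\mathrm{Lex}=\mathrm{Lex}^-$, and after deletion of all coordinates that vanish on every codeword this code is, up to a permutation of the coordinates, the $d'$-fold repetition of the ternary simplex code of dimension $k$, that is, of the row space of the matrix whose columns are the vectors of $\mathbb F_3^k$ with first nonzero entry $1$, each taken once. -/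

import Mathlib

/-- `𝔽_p^ℕ`: the finitely supported sequences indexed by `ℕ` over `𝔽_p = ZMod p`.
An ordered basis of it is a `Module.Basis ℕ (ZMod p) (FinSeq p)`. -/
abbrev FinSeq (p : ℕ) : Type := ℕ →₀ ZMod p

/-- The Hamming distance: the number of (standard) coordinates in which `x` and `y` differ. -/
def hdist {p : ℕ} (x y : FinSeq p) : ℕ := (x.neLocus y).card

/-- The order `<_F` on `𝔽_p^ℕ`: `x <_F y` iff, at the largest index at which their coordinates with
respect to `F` differ, the coordinate of `x` is smaller, where `𝔽_p = {0, 1, …, p - 1}`. -/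
def basisLT {p : ℕ} (F : Module.Basis ℕ (ZMod p) (FinSeq p)) (x y : FinSeq p) : Prop :=
  ∃ N : ℕ, (F.repr x N).val < (F.repr y N).val ∧ ∀ i, N < i → F.repr x i = F.repr y i

theorem basisLT_wf {p : ℕ} (F : Module.Basis ℕ (ZMod p) (FinSeq p)) :
    WellFounded (basisLT F) := by
  have h := Finsupp.Lex.wellFounded' (r := fun a b : ℕ => b < a)
    (s := fun a b : ZMod p => a.val < b.val) (by intro n; simp)
    (InvImage.wf ZMod.val Nat.lt_wfRel.wf) (Nat.lt_wfRel.wf)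
  refine Subrelation.wf ?_ (InvImage.wf (fun x => F.repr x) h)
  rintro x y ⟨N, h1, h2⟩
  exact ⟨N, h2, h1⟩

theorem basisLT_total {p : ℕ} [NeZero p] (F : Module.Basis ℕ (ZMod p) (FinSeq p))
    {x y : FinSeq p} (hxy : x ≠ y) : basisLT F x y ∨ basisLT F y x := by
  have hne : ((F.repr x).neLocus (F.repr y)).Nonempty := by
    rw [Finsupp.nonempty_neLocus_iff]
    exact fun h => hxy (F.repr.injective h)
  have hm := Finset.max'_mem _ hne
  have hgt : ∀ i, ((F.repr x).neLocus (F.repr y)).max' hne < i → F.repr x i = F.repr y i := by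
    intro i hi
    by_contra hc
    exact absurd (Finset.le_max' _ i (Finsupp.mem_neLocus.2 hc)) (not_le.2 hi)
  rw [Finsupp.mem_neLocus] at hm
  have hv := (ZMod.val_injective p).ne hm
  rcases lt_or_gt_of_ne hv with h | h
  · exact Or.inl ⟨_, h, hgt⟩
  · exact Or.inr ⟨_, h, fun i hi => (hgt i hi).symm⟩

open Classical in
/-- The minimum of a nonempty set `S` with respect to `<_F`. -/
noncomputable def basisMin {p : ℕ} (F : Module.Basis ℕ (ZMod p) (FinSeq p))
    (S : Set (FinSeq p)) : FinSeq p :=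
  if h : S.Nonempty then (basisLT_wf F).min S h else 0

theorem basisMin_mem {p : ℕ} (F : Module.Basis ℕ (ZMod p) (FinSeq p))
    {S : Set (FinSeq p)} (h : S.Nonempty) : basisMin F S ∈ S := by
  rw [basisMin, dif_pos h]
  exact (basisLT_wf F).min_mem S h

theorem basisMin_not_lt {p : ℕ} (F : Module.Basis ℕ (ZMod p) (FinSeq p))
    {S : Set (FinSeq p)} {x : FinSeq p} (hx : x ∈ S) : ¬ basisLT F x (basisMin F S) := by
  rw [basisMin, dif_pos ⟨x, hx⟩]
  exact (basisLT_wf F).not_lt_min S hx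

/-- The `a`-th lexicographic word: the `<_F`-least `z` whose Hamming distance from every earlier
word is at least `d`. -/
noncomputable def lexWord {p : ℕ} (F : Module.Basis ℕ (ZMod p) (FinSeq p)) (d : ℕ) :
    ℕ → FinSeq p
  | a => basisMin F {z | ∀ b : ℕ, ∀ _ : b < a, d ≤ hdist z (lexWord F d b)}
termination_by a => a

/-- `Lex` with `p ^ k` words: the lexicographic code `{word 0, …, word (p ^ k - 1)}`. -/
def lexCode {p : ℕ} (F : Module.Basis ℕ (ZMod p) (FinSeq p)) (d k : ℕ) : Set (FinSeq p) :=
  lexWord F d '' {a | a < p ^ k}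

open Classical in
/-- The modified words: if `a` is a power of `p`, the `a`-th modified word is the `<_F`-least `z`
whose distance from every earlier modified word is at least `d`; otherwise it is
`∑ i, aᵢ • (modified word of index p ^ i)`, where `aᵢ = a / p ^ i % p` is the `i`-th digit of `a`
in base `p`. (If `a` is not a power of `p`, then `aᵢ ≠ 0` forces `i < p ^ i < a`.) -/
noncomputable def modWord {p : ℕ} (F : Module.Basis ℕ (ZMod p) (FinSeq p)) (d : ℕ) :
    ℕ → FinSeq p
  | a =>
    if ∃ m : ℕ, a = p ^ m then
      basisMin F {z | ∀ b : ℕ, ∀ _ : b < a, d ≤ hdist z (modWord F d b)}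
    else
      ∑ i ∈ Finset.range a, if _ : p ^ i < a then (a / p ^ i % p) • modWord F d (p ^ i) else 0
termination_by a => a

/-- `Lex⁻` with `p ^ k` words: the modified code. -/
def modCode {p : ℕ} (F : Module.Basis ℕ (ZMod p) (FinSeq p)) (d k : ℕ) : Set (FinSeq p) :=
  modWord F d '' {a | a < p ^ k}

theorem exists_far {p : ℕ} [Fact p.Prime] (w : ℕ → FinSeq p) (d a : ℕ) :
    {z : FinSeq p | ∀ b : ℕ, ∀ _ : b < a, d ≤ hdist z (w b)}.Nonempty := by
  classical
  obtain ⟨t, hts, htc⟩ := Set.Infinite.exists_subset_card_eq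
    (Set.Finite.infinite_compl (((Finset.range a).biUnion fun b => (w b).support).finite_toSet)) d
  refine ⟨Finsupp.indicator t fun _ _ => 1, fun b hb => ?_⟩
  rw [← htc]
  refine Finset.card_le_card fun i hi => ?_
  have hw : w b i = 0 := by
    by_contra hc
    exact hts hi (Finset.mem_coe.2 (Finset.mem_biUnion.2
      ⟨b, Finset.mem_range.2 hb, Finsupp.mem_support_iff.2 hc⟩))
  rw [Finsupp.mem_neLocus, hw, Finsupp.indicator_of_mem hi]
  exact one_ne_zero

theorem lexWord_far {p : ℕ} [Fact p.Prime] (F : Module.Basis ℕ (ZMod p) (FinSeq p)) (d : ℕ)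
    {a b : ℕ} (h : b < a) : d ≤ hdist (lexWord F d a) (lexWord F d b) := by
  have := basisMin_mem F (exists_far (lexWord F d) d a)
  rw [lexWord.eq_1 F d a]
  exact this b h

theorem lexWord_least {p : ℕ} (F : Module.Basis ℕ (ZMod p) (FinSeq p)) (d a : ℕ)
    {z : FinSeq p} (hz : ∀ b < a, d ≤ hdist z (lexWord F d b)) :
    ¬ basisLT F z (lexWord F d a) := by
  rw [lexWord.eq_1 F d a]
  exact basisMin_not_lt F (S := {z | ∀ b : ℕ, ∀ _ : b < a, d ≤ hdist z (lexWord F d b)}) hz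

theorem modWord_pow_far {p : ℕ} [Fact p.Prime] (F : Module.Basis ℕ (ZMod p) (FinSeq p)) (d m : ℕ)
    {b : ℕ} (h : b < p ^ m) : d ≤ hdist (modWord F d (p ^ m)) (modWord F d b) := by
  have := basisMin_mem F (exists_far (modWord F d) d (p ^ m))
  rw [modWord.eq_1 F d (p ^ m), if_pos ⟨m, rfl⟩]
  exact this b h

theorem modWord_pow_least {p : ℕ} (F : Module.Basis ℕ (ZMod p) (FinSeq p)) (d m : ℕ)
    {z : FinSeq p} (hz : ∀ b < p ^ m, d ≤ hdist z (modWord F d b)) :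
    ¬ basisLT F z (modWord F d (p ^ m)) := by
  rw [modWord.eq_1 F d (p ^ m), if_pos ⟨m, rfl⟩]
  exact basisMin_not_lt F (S := {z | ∀ b : ℕ, ∀ _ : b < p ^ m, d ≤ hdist z (modWord F d b)}) hz

theorem modWord_of_not_pow {p : ℕ} [Fact p.Prime] (F : Module.Basis ℕ (ZMod p) (FinSeq p))
    (d : ℕ) {a : ℕ} (ha : ¬ ∃ m : ℕ, a = p ^ m) {n : ℕ} (hn : a ≤ p ^ n) :
    modWord F d a = ∑ i ∈ Finset.range n, (a / p ^ i % p) • modWord F d (p ^ i) := by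
  have hp := (Fact.out : p.Prime).one_lt
  have key : ∀ N, a ≤ p ^ N →
      (∑ i ∈ Finset.range N, if _ : p ^ i < a then (a / p ^ i % p) • modWord F d (p ^ i) else 0)
        = ∑ i ∈ Finset.range N, (a / p ^ i % p) • modWord F d (p ^ i) := by
    intro N _
    refine Finset.sum_congr rfl fun i _ => ?_
    split_ifs with h
    · rfl
    · have : a < p ^ i := lt_of_le_of_ne (not_lt.1 h) fun e => ha ⟨i, e⟩
      rw [Nat.div_eq_of_lt this, Nat.zero_mod, zero_smul]
  have mono : ∀ N M, a ≤ p ^ N → N ≤ M →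
      ∑ i ∈ Finset.range N, (a / p ^ i % p) • modWord F d (p ^ i)
        = ∑ i ∈ Finset.range M, (a / p ^ i % p) • modWord F d (p ^ i) := by
    intro N M hN hNM
    refine Finset.sum_subset (Finset.range_mono hNM) fun i _ hi => ?_
    have h1 : N ≤ i := by simpa using hi
    have : a < p ^ i := lt_of_le_of_ne (hN.trans (Nat.pow_le_pow_right hp.le h1))
      fun e => ha ⟨i, e⟩
    rw [Nat.div_eq_of_lt this, Nat.zero_mod, zero_smul]
  have hA : a ≤ p ^ a := (Nat.lt_pow_self hp).le
  rw [modWord.eq_1 F d a, if_neg ha, key a hA]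
  rcases le_total a n with h | h
  · exact mono a n hA h
  · exact (mono n a hn h).symm

/-- The linear automorphism `x ↦ x + x_ξ e_η` of `𝔽_p^ℕ`, for `ξ ≠ η`. -/
noncomputable def shearEquiv (p : ℕ) {ξ η : ℕ} (h : ξ ≠ η) : FinSeq p ≃ₗ[ZMod p] FinSeq p where
  toFun x := x + Finsupp.single η (x ξ)
  invFun x := x - Finsupp.single η (x ξ)
  map_add' x y := by
    ext i
    simp only [Finsupp.add_apply, Finsupp.single_add]
    ring
  map_smul' c x := by
    ext i
    simp
  left_inv x := by
    ext i
    simp [h.symm]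
  right_inv x := by
    ext i
    simp [h.symm]

/-- The standard basis `E = (e₀, e₁, …)` of `𝔽_p^ℕ`. -/
noncomputable def stdBasis (p : ℕ) : Module.Basis ℕ (ZMod p) (FinSeq p) :=
  Finsupp.basisSingleOne

/-- The basis `F(ξ, η)`: the standard basis with its `ξ`-th element replaced by `e_ξ + e_η`
(see `twistedBasis_apply`). -/
noncomputable def twistedBasis (p : ℕ) {ξ η : ℕ} (h : ξ ≠ η) :
    Module.Basis ℕ (ZMod p) (FinSeq p) :=
  (stdBasis p).map (shearEquiv p h)

theorem stdBasis_apply (p i : ℕ) : stdBasis p i = Finsupp.single i 1 := by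
  simp [stdBasis]

theorem twistedBasis_apply (p : ℕ) {ξ η : ℕ} (h : ξ ≠ η) (i : ℕ) :
    twistedBasis p h i =
      if i = ξ then Finsupp.single ξ 1 + Finsupp.single η 1 else Finsupp.single i 1 := by
  rw [twistedBasis, Module.Basis.map_apply, stdBasis_apply]
  change Finsupp.single i 1 + Finsupp.single η ((Finsupp.single i (1 : ZMod p)) ξ) = _
  split_ifs with hi
  · subst hi
    simp
  · simp [hi]

/-- The family of bases consisting of `E` and all `F(ξ, η)` with `ξ ≠ η`. -/
def basisFamily (p : ℕ) : Set (Module.Basis ℕ (ZMod p) (FinSeq p)) :=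
  {stdBasis p} ∪ {F | ∃ (ξ η : ℕ) (h : ξ ≠ η), F = twistedBasis p h}

/-- A code is linear if it is (the underlying set of) a linear subspace. -/
def IsLinearCode {p : ℕ} (C : Set (FinSeq p)) : Prop :=
  ∃ W : Submodule (ZMod p) (FinSeq p), (W : Set (FinSeq p)) = C

/-- The support of a code: the coordinates in which some codeword does not vanish. -/
def codeSupport {p : ℕ} (C : Set (FinSeq p)) : Set ℕ := {i | ∃ x ∈ C, x i ≠ 0}

/-- The restriction of a code to its support: the coordinates outside of it are deleted. -/
def codeRes {p : ℕ} (C : Set (FinSeq p)) : Set (codeSupport C → ZMod p) :=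
  (fun (x : FinSeq p) (i : codeSupport C) => x i) '' C

/-- The standard representatives of the one-dimensional subspaces of `𝔽_p^k`: the vectors whose
first nonzero entry is `1`. There are `(p ^ k - 1) / (p - 1)` of them. -/
def ProjRep (p k : ℕ) : Type :=
  {v : Fin k → ZMod p // ∃ i, v i = 1 ∧ ∀ j, j < i → v j = 0}

/-- The `p`-ary simplex code of dimension `k`, with coordinates indexed by `ProjRep p k`: the row
space of the matrix whose columns are the elements of `ProjRep p k`, each taken once. -/
def simplexCode (p k : ℕ) : Set (ProjRep p k → ZMod p) :=
  Set.range fun (a : Fin k → ZMod p) (v : ProjRep p k) => ∑ i, a i * v.1 i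

/-- After a bijective relabelling of its coordinates, the code `C` consists of the words of `D`
with every coordinate repeated `r` times. -/
def IsRepetitionOf {p : ℕ} {ι κ : Type} (r : ℕ) (C : Set (ι → ZMod p)) (D : Set (κ → ZMod p)) :
    Prop :=
  ∃ e : ι ≃ κ × Fin r, C = (fun (c : κ → ZMod p) (i : ι) => c (e i).1) '' D

/-! Index the words of the `r`-fold simplex code, `r = d'`, by coefficient vectors `a`, compared at
their last differing entry. Let the columns decrease lexicographically (first entry most
significant) in blocks of `r` as the coordinate grows, with zero columns beyond; a twisted basis
needs a slight permutation of the places. Everything reduces to `IsGreedy`: a sequence `y` far from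
all words preceding the word of `a` is not below that word. Since the code has distance `d`
(`le_hdist_word`), induction then identifies both greedy constructions with it (`IsGreedy.eq_word`).

Greediness comes from averaging (`three_mul_le_of_far`). Average the distance from `y` over earlier
words whose coefficients from `t` on and whose inner product with `v` are fixed. A column whose
prefix before `t` is neither zero nor that of `v` takes all values equally often and contributes
2/3; the other columns are constant on the family. This bounds how often `y` can take shifted values
on the columns with prefix `v` (`Far.le_card_zero`, `Far.card_le_zero`). If `y` agrees with the word
on the lexicographically smaller columns, these bounds are already tight, which forbids most changes
at the next column (`Far.not_shift`, `Far.not_two_ones`). Arithmetic in `ZMod 3` excludes a decrease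
(`Far.not_lt`).

For `F(ξ, η)` only the coordinate at `η` changes, to `x η - x ξ`. If `η < ξ`, then `x ξ` is settled
before `η` is compared, and `η` receives a column dominating that of `ξ` up to a cut and equal to it
afterwards (`exists_slot`). If `ξ < η`, both places go into one block (`exists_pairing`): all
codewords have coordinate zero at `η`, and a change at `ξ` happens on two columns, outweighing the
at most one misplaced column. This is where `2 ≤ d'` matters. -/

/-- The first nonzero entry of `v` is `1`. -/
def IsProjRep {k : ℕ} (v : Fin k → ZMod 3) : Prop := ∃ i, v i = 1 ∧ ∀ j, j < i → v j = 0

theorem IsProjRep.ne_zero {k : ℕ} {v : Fin k → ZMod 3} (h : IsProjRep v) : v ≠ 0 := by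
  obtain ⟨i, hi, -⟩ := h
  rintro rfl
  simp at hi

theorem IsProjRep.eq_one {k : ℕ} {v : Fin k → ZMod 3} (h : IsProjRep v) {t : Fin k}
    (h0 : ∀ j, j < t → v j = 0) (ht : v t ≠ 0) : v t = 1 := by
  obtain ⟨i, hi, hj⟩ := h
  rcases lt_trichotomy i t with hit | rfl | hit
  · rw [h0 i hit] at hi
    simp at hi
  · exact hi
  · exact absurd (hj t hit) ht

/-! ### Column families and counting by prefixes -/

/-- A family of columns in `𝔽₃^k` indexed by `ℕ`, almost all of them zero, in which every
normalized vector occurs exactly `r` times and no other nonzero vector occurs. -/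
structure SimplexColumns (k r : ℕ) where
  /-- the columns -/
  col : ℕ → Fin k → ZMod 3
  /-- the indices of the nonzero columns -/
  supp : Finset ℕ
  mem_supp : ∀ i, i ∈ supp ↔ col i ≠ 0
  proj : ∀ i ∈ supp, IsProjRep (col i)
  card_fiber : ∀ v, IsProjRep v → (supp.filter fun i => col i = v).card = r

namespace SimplexColumns

variable {k r : ℕ} (S : SimplexColumns k r)

/-- The row with coefficients `a` of the matrix with the given columns. -/
noncomputable def word : (Fin k → ZMod 3) →ₗ[ZMod 3] FinSeq 3 where
  toFun a := Finsupp.onFinset S.supp (fun i => ∑ j, a j * S.col i j) (by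
    intro i hi
    rw [S.mem_supp]
    intro h
    simp [h] at hi)
  map_add' a b := by
    ext i
    simp [add_mul, Finset.sum_add_distrib]
  map_smul' c a := by
    ext i
    simp [Finset.mul_sum, mul_assoc]

theorem word_apply (a : Fin k → ZMod 3) (i : ℕ) : S.word a i = ∑ j, a j * S.col i j := rfl

theorem proj_of_ne {i : ℕ} {t : Fin k} (h : S.col i t ≠ 0) : IsProjRep (S.col i) :=
  S.proj i ((S.mem_supp i).2 fun h0 => h (by simp [h0]))

theorem mem_supp_of_ne {i : ℕ} {t : Fin k} (h : S.col i t ≠ 0) : i ∈ S.supp :=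
  (S.mem_supp i).2 fun h0 => h (by simp [h0])

theorem card_filter_mem (A : Finset (Fin k → ZMod 3)) (hA : ∀ v ∈ A, IsProjRep v) :
    (S.supp.filter fun i => S.col i ∈ A).card = r * A.card := by
  have hm : ∀ i ∈ S.supp.filter fun i => S.col i ∈ A, S.col i ∈ A :=
    fun i hi => (Finset.mem_filter.1 hi).2
  rw [Finset.card_eq_sum_card_fiberwise hm, mul_comm, ← smul_eq_mul,
    ← Finset.sum_const]
  refine Finset.sum_congr rfl fun v hv => ?_
  refine Eq.trans ?_ (S.card_fiber v (hA v hv))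
  rw [Finset.filter_filter]
  congr 1
  ext i
  simp only [Finset.mem_filter]
  constructor
  · rintro ⟨h1, -, h2⟩
    exact ⟨h1, h2⟩
  · rintro ⟨h1, h2⟩
    exact ⟨h1, h2 ▸ hv, h2⟩

/-- The indices of the nonzero columns that agree with `v` up to and including the entry `t`. -/
def agree (t : Fin k) (v : Fin k → ZMod 3) : Finset ℕ :=
  S.supp.filter fun i => ∀ j, j ≤ t → S.col i j = v j

/-- A leading 1 within the prefix makes every completion normalized, so the `k - 1 - t` entries
after `t` are free. -/
theorem card_agree (t : Fin k) (v : Fin k → ZMod 3)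
    (hv : ∃ s, s ≤ t ∧ v s = 1 ∧ ∀ j, j < s → v j = 0) :
    (S.agree t v).card = r * 3 ^ (k - 1 - t) := by
  obtain ⟨s, hst, hs1, hs0⟩ := hv
  have h := S.card_filter_mem (Fintype.piFinset fun j => if j ≤ t then {v j} else Finset.univ) (by
    intro w hw
    have hw' : ∀ j, j ≤ t → w j = v j := by
      intro j hj
      have := Fintype.mem_piFinset.1 hw j
      simpa [hj] using this
    refine ⟨s, by rw [hw' s hst, hs1], fun j hj => ?_⟩
    rw [hw' j (hj.le.trans hst), hs0 j hj])
  have hc : (Fintype.piFinset fun j => if j ≤ t then {v j} else (Finset.univ : Finset (ZMod 3))).card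
      = 3 ^ (k - 1 - t) := by
    rw [Fintype.card_piFinset]
    have : ∀ j, (if j ≤ t then {v j} else (Finset.univ : Finset (ZMod 3))).card
        = if j ∈ Finset.Ioi t then 3 else 1 := by
      intro j
      by_cases hj : j ≤ t
      · simp [hj]
      · simp [hj, ZMod.card]
    simp only [this]
    rw [Finset.prod_ite_mem, Finset.univ_inter, Finset.prod_const, Fin.card_Ioi]
  rw [hc] at h
  rw [← h, agree]
  congr 1
  ext i
  simp only [Finset.mem_filter, Fintype.mem_piFinset, and_congr_right_iff]
  intro _
  refine forall_congr' fun j => ?_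
  by_cases hj : j ≤ t <;> simp [hj]

/-- The indices of the columns with a nonzero entry before the `t`-th one. -/
def pre (t : ℕ) : Finset ℕ := S.supp.filter fun i => ∃ j : Fin k, j.val < t ∧ S.col i j ≠ 0

/-- Passing from `t` to `t + 1` adds the columns whose leading entry sits at `t`. Normalization
makes that entry 1, so they are counted by `card_agree`. -/
theorem two_mul_card_pre {t : ℕ} (ht : t ≤ k) :
    2 * (S.pre t).card + r * 3 ^ (k - t) = r * 3 ^ k := by
  induction t with
  | zero => simp [pre]
  | succ t ih =>
    have htk : t < k := ht
    have key : S.pre (t + 1) = S.pre t ∪ S.agree ⟨t, htk⟩ (Pi.single ⟨t, htk⟩ 1) := by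
      ext i
      simp only [pre, agree, Finset.mem_union, Finset.mem_filter, ← and_or_left,
        and_congr_right_iff]
      intro hi
      constructor
      · rintro ⟨j, hj, hne⟩
        by_cases hp : ∃ j : Fin k, j.val < t ∧ S.col i j ≠ 0
        · exact Or.inl hp
        · right
          push Not at hp
          have hjt : j = ⟨t, htk⟩ := by
            apply Fin.ext
            by_contra hc
            exact hne (hp j (by simp at hc; omega))
          subst hjt
          intro j hj
          rcases hj.lt_or_eq with h | rfl
          · rw [hp j h, Pi.single_eq_of_ne h.ne]
          · rw [(S.proj i hi).eq_one (fun j hj => hp j hj) hne, Pi.single_eq_same]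
      · rintro (⟨j, hj, hne⟩ | h)
        · exact ⟨j, by omega, hne⟩
        · refine ⟨⟨t, htk⟩, by simp, ?_⟩
          rw [h _ le_rfl]
          simp
    have hd : Disjoint (S.pre t) (S.agree ⟨t, htk⟩ (Pi.single ⟨t, htk⟩ 1)) := by
      rw [Finset.disjoint_left]
      intro i hi hi'
      simp only [pre, agree, Finset.mem_filter] at hi hi'
      obtain ⟨-, j, hj, hne⟩ := hi
      have hjt : j < ⟨t, htk⟩ := hj
      apply hne
      rw [hi'.2 j hjt.le, Pi.single_eq_of_ne hjt.ne]
    rw [key, Finset.card_union_of_disjoint hd, S.card_agree _ _ ⟨⟨t, htk⟩, le_rfl, by simp,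
      fun j hj => Pi.single_eq_of_ne hj.ne _⟩]
    have ih := ih htk.le
    have e1 : k - t = (k - 1 - t) + 1 := by omega
    have e2 : k - (t + 1) = k - 1 - t := by omega
    rw [e1, pow_succ] at ih
    rw [e2]
    simp only
    linarith

theorem hdist_eq {x y : FinSeq 3} {N : Finset ℕ} (hx : x.support ⊆ N) (hy : y.support ⊆ N) :
    hdist x y = (N.filter fun i => x i ≠ y i).card := by
  rw [hdist]
  congr 1
  ext i
  simp only [Finsupp.mem_neLocus, Finset.mem_filter, iff_and_self]
  intro h
  by_contra hc
  apply h
  rw [Finsupp.notMem_support_iff.1 fun h => hc (hx h), Finsupp.notMem_support_iff.1 fun h => hc (hy h)]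

theorem support_word (a : Fin k → ZMod 3) : (S.word a).support ⊆ S.supp := by
  intro i hi
  rw [Finsupp.mem_support_iff, word_apply] at hi
  rw [S.mem_supp]
  intro h
  simp [h] at hi

/-! ### Equidistribution and averaging -/

/-- A linear form that is not constant on a set invariant under translations takes all three values
equally often. -/
theorem three_mul_card_eq {V : Type*} [AddCommGroup V] [DecidableEq V] (A : Finset V)
    (f : V → ZMod 3) (l : V) (hA : ∀ u ∈ A, u + l ∈ A) (hf : ∀ u, f (u + l) = f u + 1)
    (c : ZMod 3) : 3 * (A.filter fun u => f u = c).card = A.card := by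
  -- Translation by `l` injects each level set into the next; going once around the cycle of three
  -- values forces equal sizes.
  have step : ∀ c, (A.filter fun u => f u = c).card ≤ (A.filter fun u => f u = c + 1).card := by
    intro c
    refine Finset.card_le_card_of_injOn (· + l) ?_ fun x _ y _ h => add_right_cancel h
    intro u hu
    simp only [Finset.coe_filter, Set.mem_ofPred_eq] at hu ⊢
    exact ⟨hA u hu.1, by rw [hf, hu.2]⟩
  have h1 := step c
  have h2 := step (c + 1)
  have h3 := step (c + 1 + 1)
  have e : c + 1 + 1 + 1 = c := by
    rw [add_assoc, add_assoc, show (1 : ZMod 3) + (1 + 1) = 0 from rfl, add_zero]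
  rw [e] at h3
  have htot := Finset.card_eq_sum_card_fiberwise (f := f) (s := A) (t := Finset.univ)
    (fun i _ => Finset.mem_coe.2 (Finset.mem_univ _))
  have hu : ∀ c : ZMod 3, (Finset.univ : Finset (ZMod 3)) = {c, c + 1, c + 1 + 1} ∧
    c ∉ ({c + 1, c + 1 + 1} : Finset (ZMod 3)) ∧ c + 1 ∉ ({c + 1 + 1} : Finset (ZMod 3)) := by
    decide
  obtain ⟨hu1, hu2, hu3⟩ := hu c
  rw [hu1, Finset.sum_insert hu2, Finset.sum_insert hu3, Finset.sum_singleton] at htot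
  omega

/-- The obstruction would be that the prefix of `c` is a multiple of that of `v`. With the leading 1
of `v` at `s`, the factor is `c s`; as `c` is normalized with nonzero prefix, the factor would be 1
and the prefixes equal. The vector `l` serves as a translation of the averaging family. -/
theorem exists_shift {t : Fin k} {v c : Fin k → ZMod 3}
    (hv : (∀ j, j < t → v j = 0) ∨ ∃ s, s < t ∧ v s = 1 ∧ ∀ j, j < s → v j = 0)
    (hc : IsProjRep c) (h0 : ∃ j, j < t ∧ c j ≠ 0) (h1 : ∃ j, j < t ∧ c j ≠ v j) :
    ∃ l : Fin k → ZMod 3, (∀ j, t ≤ j → l j = 0) ∧ l ⬝ᵥ v = 0 ∧ l ⬝ᵥ c = 1 := by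
  rcases hv with hv | ⟨s, hst, hs1, hs0⟩
  · obtain ⟨j, hj, hne⟩ := h0
    refine ⟨Pi.single j (c j)⁻¹, fun i hi => Pi.single_eq_of_ne (hj.trans_le hi).ne' _, ?_, ?_⟩
    · rw [single_dotProduct, hv j hj, mul_zero]
    · rw [single_dotProduct, inv_mul_cancel₀ hne]
  · have : ∃ j, j < t ∧ c j - v j * c s ≠ 0 := by
      by_contra! hall
      have hall' : ∀ j, j < t → c j = v j * c s := fun j hj => sub_eq_zero.1 (hall j hj)
      by_cases hcs : c s = 0
      · obtain ⟨j, hj, hne⟩ := h0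
        exact hne (by rw [hall' j hj, hcs, mul_zero])
      · have hcs1 : c s = 1 := hc.eq_one
          (fun j hj => by rw [hall' j (hj.trans hst), hs0 j hj, zero_mul]) hcs
        obtain ⟨j, hj, hne⟩ := h1
        exact hne (by rw [hall' j hj, hcs1, mul_one])
    obtain ⟨j, hj, hne⟩ := this
    refine ⟨(c j - v j * c s)⁻¹ • (Pi.single j 1 - Pi.single s (v j)), ?_, ?_, ?_⟩
    · intro i hi
      simp [Pi.single_eq_of_ne (hj.trans_le hi).ne', Pi.single_eq_of_ne (hst.trans_le hi).ne']
    · rw [smul_dotProduct, sub_dotProduct, single_dotProduct, single_dotProduct, hs1]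
      simp
    · rw [smul_dotProduct, sub_dotProduct, single_dotProduct, single_dotProduct, one_mul,
        smul_eq_mul, inv_mul_cancel₀ hne]

/-- The distance from `y` to the words `u` with prescribed coefficients from the `t`-th on and with
a prescribed inner product with `v`, averaged over these words. -/
theorem three_mul_le_of_far {t : Fin k} {v u₀ : Fin k → ZMod 3} {y : FinSeq 3} {d : ℕ}
    (hv : (∀ j, j < t → v j = 0) ∨ ∃ s, s < t ∧ v s = 1 ∧ ∀ j, j < s → v j = 0)
    (hd : ∀ u, (∀ j, t ≤ j → u j = u₀ j) → d ≤ hdist y (S.word u)) :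
    3 * d ≤ 2 * (S.supp.filter fun i => (∃ j, j < t ∧ S.col i j ≠ 0) ∧
        ∃ j, j < t ∧ S.col i j ≠ v j).card +
      3 * ((S.supp ∪ y.support).filter fun i => ¬ ((∃ j, j < t ∧ S.col i j ≠ 0) ∧
        ∃ j, j < t ∧ S.col i j ≠ v j) ∧ y i ≠ S.word u₀ i).card := by
  classical
  set v' : Fin k → ZMod 3 := fun j => if j < t then v j else 0 with hv'
  have hvlt : ∀ j, j < t → v' j = v j := fun j hj => by simp [hv', hj]
  set I : ℕ → Prop := fun i => (∃ j, j < t ∧ S.col i j ≠ 0) ∧ ∃ j, j < t ∧ S.col i j ≠ v j with hI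
  set N := S.supp ∪ y.support with hN
  set A : Finset (Fin k → ZMod 3) :=
    Finset.univ.filter fun u => (∀ j, t ≤ j → u j = u₀ j) ∧ u ⬝ᵥ v' = u₀ ⬝ᵥ v' with hA
  have hpos : 0 < A.card := Finset.card_pos.2 ⟨u₀, by simp [hA]⟩
  have hconst : ∀ i, ¬ I i → ∀ u ∈ A, S.word u i = S.word u₀ i := by
    intro i hi u hu
    simp only [hA, Finset.mem_filter, Finset.mem_univ, true_and] at hu
    rw [← sub_eq_zero, ← Finsupp.sub_apply, ← map_sub, word_apply]
    by_cases h0 : ∃ j, j < t ∧ S.col i j ≠ 0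
    · have h1 : ∀ j, j < t → S.col i j = v' j := by
        intro j hj
        rw [hvlt j hj]
        by_contra hc
        exact hi ⟨h0, j, hj, hc⟩
      have h2 : (u - u₀) ⬝ᵥ v' = 0 := by rw [sub_dotProduct, hu.2, sub_self]
      rw [← h2]
      refine Finset.sum_congr rfl fun j _ => ?_
      rcases lt_or_ge j t with hj | hj
      · rw [h1 j hj]
      · simp [hu.1 j hj]
    · push Not at h0
      refine Finset.sum_eq_zero fun j _ => ?_
      rcases lt_or_ge j t with hj | hj
      · rw [h0 j hj, mul_zero]
      · simp [hu.1 j hj]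
  -- The translation from `exists_shift` preserves `A` and raises the value at `i` by 1, so `y i` is
  -- missed by two thirds of `A`.
  have hthird : ∀ i ∈ S.supp, I i → 3 * (A.filter fun u => y i ≠ S.word u i).card = 2 * A.card := by
    intro i hi hIi
    obtain ⟨l, hl1, hl2, hl3⟩ := exists_shift (t := t) (v := v') (c := S.col i)
      (hv.imp (fun h j hj => (hvlt j hj).trans (h j hj)) fun ⟨s, h1, h2, h3⟩ =>
        ⟨s, h1, (hvlt s h1).trans h2, fun j hj => (hvlt j (hj.trans h1)).trans (h3 j hj)⟩)
      (S.proj i hi) hIi.1 (hIi.2.imp fun j hj => ⟨hj.1, by rw [hvlt j hj.1]; exact hj.2⟩)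
    have h3 := three_mul_card_eq A (fun u => S.word u i) l (by
      intro u hu
      simp only [hA, Finset.mem_filter, Finset.mem_univ, true_and] at hu ⊢
      exact ⟨fun j hj => by rw [Pi.add_apply, hl1 j hj, add_zero, hu.1 j hj],
        by rw [add_dotProduct, hl2, add_zero, hu.2]⟩) (by
      intro u
      change S.word (u + l) i = S.word u i + 1
      rw [map_add, Finsupp.add_apply, ← hl3]
      rfl) (y i)
    have h4 := Finset.card_filter_add_card_filter_not (s := A) (fun u => S.word u i = y i)
    have h5 : (A.filter fun u => ¬ S.word u i = y i) = A.filter fun u => y i ≠ S.word u i := by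
      simp only [ne_eq, eq_comm]
    rw [h5] at h4
    omega
  -- Double counting of the pairs of a word and a coordinate where it differs from `y`.
  have hsum : A.card * d ≤ ∑ i ∈ N, (A.filter fun u => y i ≠ S.word u i).card := by
    calc A.card * d = ∑ u ∈ A, d := by rw [Finset.sum_const, smul_eq_mul]
      _ ≤ ∑ u ∈ A, (N.filter fun i => y i ≠ S.word u i).card := by
        refine Finset.sum_le_sum fun u hu => ?_
        rw [← hdist_eq Finset.subset_union_right
          ((S.support_word u).trans Finset.subset_union_left)]
        exact hd u (Finset.mem_filter.1 hu).2.1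
      _ = _ := by
        simp only [Finset.card_filter]
        exact Finset.sum_comm
  have hI1 : N.filter I = S.supp.filter I := by
    ext i
    simp only [Finset.mem_filter, hN, Finset.mem_union]
    constructor
    · rintro ⟨-, h⟩
      obtain ⟨j, -, hj⟩ := h.1
      exact ⟨S.mem_supp_of_ne hj, h⟩
    · rintro ⟨h1, h2⟩
      exact ⟨Or.inl h1, h2⟩
  have hle : 3 * ∑ i ∈ N, (A.filter fun u => y i ≠ S.word u i).card =
      A.card * (2 * (S.supp.filter I).card +
        3 * (N.filter fun i => ¬ I i ∧ y i ≠ S.word u₀ i).card) := by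
    rw [← Finset.sum_filter_add_sum_filter_not N I, mul_add, mul_add, hI1]
    congr 1
    · rw [Finset.mul_sum, Finset.sum_congr rfl fun i hi => hthird i (Finset.mem_filter.1 hi).1
        (Finset.mem_filter.1 hi).2, Finset.sum_const, smul_eq_mul]
      ring
    · rw [← Finset.filter_filter, mul_left_comm]
      congr 1
      rw [Finset.card_filter _ (Finset.filter _ N), Finset.mul_sum]
      refine Finset.sum_congr rfl fun i hi => ?_
      have hi' := (Finset.mem_filter.1 hi).2
      split_ifs with h
      · rw [mul_one, Finset.filter_true_of_mem fun u hu => by rwa [hconst i hi' u hu]]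
      · rw [mul_zero, Finset.filter_false_of_mem fun u hu => by rwa [hconst i hi' u hu],
          Finset.card_empty]
  refine Nat.le_of_mul_le_mul_left ?_ hpos
  rw [← hle]
  linarith

end SimplexColumns

/-! ### Minimum distance and the basic counting bounds -/

namespace SimplexColumns

variable {k r : ℕ} (S : SimplexColumns k r)

theorem word_single (t : Fin k) (c : ZMod 3) (i : ℕ) :
    S.word (Pi.single t c) i = c * S.col i t :=
  single_dotProduct (S.col i) c t

theorem coe_pre (t : Fin k) :
    S.pre t = S.supp.filter fun i => ∃ j, j < t ∧ S.col i j ≠ 0 := by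
  simp only [pre, Fin.lt_def]

theorem pow_sub_eq (t : Fin k) : 3 ^ (k - t.val) = 3 * 3 ^ (k - 1 - t.val) := by
  rw [← pow_succ']
  congr 1
  omega

theorem three_mul_pow (t : Fin k) : 3 * 3 ^ (k - 1) = 3 ^ k := by
  rw [← pow_succ']
  congr 1
  have := t.2
  omega

/-- Let `t` be the last nonzero entry of `x`. On the columns nonzero before `t`, adding multiples of
the `t`-th unit vector equidistributes the inner product with `x`, giving 2/3 of `S.pre t`. The
columns with leading entry at `t` all count, and the two contributions add up to the bound. -/
theorem le_card_word_ne {x : Fin k → ZMod 3} (hx : x ≠ 0) :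
    r * 3 ^ (k - 1) ≤ (S.supp.filter fun i => S.word x i ≠ 0).card := by
  classical
  have hne : (Finset.univ.filter fun j => x j ≠ 0).Nonempty := by
    obtain ⟨j, hj⟩ := Function.ne_iff.1 hx
    exact ⟨j, by simpa using hj⟩
  set t := (Finset.univ.filter fun j => x j ≠ 0).max' hne with ht
  have htx : x t ≠ 0 := (Finset.mem_filter.1 (Finset.max'_mem _ hne)).2
  have hgt : ∀ j, t < j → x j = 0 := by
    intro j hj
    by_contra hc
    exact absurd (Finset.le_max' _ j (Finset.mem_filter.2 ⟨Finset.mem_univ _, hc⟩)) (not_le.2 hj)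
  set A : Finset (Fin k → ZMod 3) :=
    Finset.univ.filter fun c => IsProjRep c ∧ ∃ j, j < t ∧ c j ≠ 0 with hA
  have hAp : ∀ v ∈ A, IsProjRep v := fun v hv => (Finset.mem_filter.1 hv).2.1
  have h1 := three_mul_card_eq A (fun c => x ⬝ᵥ c) (Pi.single t (x t)⁻¹) (by
    intro c hc
    simp only [hA, Finset.mem_filter, Finset.mem_univ, true_and] at hc ⊢
    obtain ⟨⟨s, hs1, hs0⟩, j, hj, hne⟩ := hc
    have hst : s < t := by
      by_contra hst
      exact hne (hs0 j (hj.trans_le (not_lt.1 hst)))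
    have he : ∀ j, j < t → (c + Pi.single t (x t)⁻¹ : Fin k → ZMod 3) j = c j := fun j hj => by
      simp [Pi.single_eq_of_ne hj.ne]
    exact ⟨⟨s, (he s hst).trans hs1, fun j hj => (he j (hj.trans hst)).trans (hs0 j hj)⟩,
      j, hj, by rwa [he j hj]⟩) (by
    intro c
    rw [dotProduct_add, dotProduct_single, mul_inv_cancel₀ htx]) 0
  have h2 := S.card_filter_mem A hAp
  have h3 := S.card_filter_mem (A.filter fun c => x ⬝ᵥ c ≠ 0)
    fun v hv => hAp v (Finset.mem_filter.1 hv).1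
  have h4 := Finset.card_filter_add_card_filter_not (s := A) (fun c => x ⬝ᵥ c = 0)
  have h5 : (S.supp.filter fun i => S.col i ∈ A) = S.pre t := by
    rw [coe_pre]
    ext i
    simp only [Finset.mem_filter, hA, Finset.mem_univ, true_and, and_congr_right_iff]
    exact fun hi => ⟨fun h => h.2, fun h => ⟨S.proj i hi, h⟩⟩
  have h6 := S.two_mul_card_pre t.2.le
  have h7 := S.card_agree t (Pi.single t 1) ⟨t, le_rfl, by simp,
    fun j hj => Pi.single_eq_of_ne hj.ne _⟩
  have h8 : (S.supp.filter fun i => S.col i ∈ A.filter fun c => x ⬝ᵥ c ≠ 0) ∪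
      S.agree t (Pi.single t 1) ⊆ S.supp.filter fun i => S.word x i ≠ 0 := by
    intro i hi
    rcases Finset.mem_union.1 hi with hi | hi
    · obtain ⟨hi1, hi2⟩ := Finset.mem_filter.1 hi
      exact Finset.mem_filter.2 ⟨hi1, (Finset.mem_filter.1 hi2).2⟩
    · obtain ⟨hi1, hi2⟩ := Finset.mem_filter.1 hi
      refine Finset.mem_filter.2 ⟨hi1, ?_⟩
      rw [word_apply, Finset.sum_eq_single t]
      · rw [hi2 t le_rfl]
        simpa using htx
      · intro j _ hj
        rcases lt_or_gt_of_ne hj with h | h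
        · rw [hi2 j h.le, Pi.single_eq_of_ne hj, mul_zero]
        · rw [hgt j h, zero_mul]
      · simp
  have h9 : Disjoint (S.supp.filter fun i => S.col i ∈ A.filter fun c => x ⬝ᵥ c ≠ 0)
      (S.agree t (Pi.single t 1)) := by
    rw [Finset.disjoint_left]
    intro i hi hi'
    obtain ⟨-, j, hj, hne⟩ :=
      (Finset.mem_filter.1 (Finset.mem_filter.1 (Finset.mem_filter.1 hi).2).1).2
    apply hne
    rw [(Finset.mem_filter.1 hi').2 j hj.le, Pi.single_eq_of_ne hj.ne]
  have h10 := Finset.card_le_card h8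
  rw [Finset.card_union_of_disjoint h9, h3, h7] at h10
  rw [h5] at h2
  rw [pow_sub_eq t, h2] at h6
  rw [← three_mul_pow t] at h6
  refine le_trans ?_ h10
  have h11 : 3 * (A.filter fun c => ¬ x ⬝ᵥ c = 0).card = 2 * A.card := by omega
  have h12 : r * (3 * (A.filter fun c => ¬ x ⬝ᵥ c = 0).card) = r * (2 * A.card) := by rw [h11]
  simp only [ne_eq]
  linarith

theorem le_hdist_word {a b : Fin k → ZMod 3} (h : a ≠ b) :
    r * 3 ^ (k - 1) ≤ hdist (S.word a) (S.word b) := by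
  rw [hdist_eq (S.support_word a) (S.support_word b)]
  refine (S.le_card_word_ne (sub_ne_zero.2 h)).trans_eq (congrArg _ ?_)
  refine Finset.filter_congr fun i _ => ?_
  rw [map_sub, Finsupp.sub_apply, sub_ne_zero]

/-- `y` has the distance of a simplex code from all words that precede the word `a`. -/
def Far (y : FinSeq 3) (a : Fin k → ZMod 3) : Prop :=
  ∀ u : Fin k → ZMod 3, (∃ t, (u t).val < (a t).val ∧ ∀ j, t < j → u j = a j) →
    r * 3 ^ (k - 1) ≤ hdist y (S.word u)

variable {S} {y : FinSeq 3} {a : Fin k → ZMod 3}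

/-- Averaging with `v = 0` over words that precede `a` because their `t`-th coefficient is `a t -
e`: what 2/3 of `S.pre t` lacks must come from the columns that vanish before `t`. -/
theorem Far.le_card_zero (h : S.Far y a) {t : Fin k} {e : ZMod 3}
    (he : (a t - e).val < (a t).val) :
    r * 3 ^ (k - 1 - t) ≤ ((S.supp ∪ y.support).filter fun i => (∀ j, j < t → S.col i j = 0) ∧
      y i ≠ S.word a i - e * S.col i t).card := by
  have hav := S.three_mul_le_of_far (t := t) (v := 0) (u₀ := a - Pi.single t e) (y := y)
    (d := r * 3 ^ (k - 1)) (Or.inl fun _ _ => rfl) (by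
      intro u hu
      refine h u ⟨t, by rw [hu t le_rfl]; simpa using he, fun j hj => ?_⟩
      rw [hu j hj.le]
      simp [Pi.single_eq_of_ne hj.ne'])
  have e1 : (S.supp.filter fun i => (∃ j, j < t ∧ S.col i j ≠ 0) ∧
      ∃ j, j < t ∧ S.col i j ≠ (0 : Fin k → ZMod 3) j) = S.pre t := by
    rw [coe_pre]
    simp
  have e2 : ((S.supp ∪ y.support).filter fun i => ¬ ((∃ j, j < t ∧ S.col i j ≠ 0) ∧
      ∃ j, j < t ∧ S.col i j ≠ (0 : Fin k → ZMod 3) j) ∧ y i ≠ S.word (a - Pi.single t e) i) =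
      (S.supp ∪ y.support).filter fun i => (∀ j, j < t → S.col i j = 0) ∧
        y i ≠ S.word a i - e * S.col i t := by
    refine Finset.filter_congr fun i _ => ?_
    rw [map_sub, Finsupp.sub_apply, word_single]
    simp
  have h6 := S.two_mul_card_pre t.2.le
  rw [e1, e2, mul_left_comm, three_mul_pow t] at hav
  rw [pow_sub_eq t] at h6
  linarith

/-- The same averaging, now also keeping the columns with prefix `v` constant. Adding `e * b` to the
coefficient at the leading position `s` makes the family take the value `S.word a i + e * (b - S.col
i t)` there, with `b` at free choice. -/
theorem Far.card_le_zero (h : S.Far y a) {t s : Fin k} {v : Fin k → ZMod 3} {e : ZMod 3}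
    (he : (a t - e).val < (a t).val) (hst : s < t) (hs1 : v s = 1) (hs0 : ∀ j, j < s → v j = 0)
    (b : ZMod 3) :
    (S.supp.filter fun i => (∀ j, j < t → S.col i j = v j) ∧
      y i = S.word a i + e * (b - S.col i t)).card ≤
    ((S.supp ∪ y.support).filter fun i => (∀ j, j < t → S.col i j = 0) ∧
      y i ≠ S.word a i - e * S.col i t).card := by
  classical
  set u₀ : Fin k → ZMod 3 := a + Pi.single s (e * b) - Pi.single t e with hu₀
  have hw : ∀ i, S.word u₀ i = S.word a i + e * b * S.col i s - e * S.col i t := by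
    intro i
    rw [hu₀, map_sub, map_add, Finsupp.sub_apply, Finsupp.add_apply, word_single, word_single]
  have hav := S.three_mul_le_of_far (t := t) (v := v) (u₀ := u₀) (y := y)
    (d := r * 3 ^ (k - 1)) (Or.inr ⟨s, hst, hs1, hs0⟩) (by
      intro u hu
      refine h u ⟨t, ?_, fun j hj => ?_⟩
      · rw [hu t le_rfl, hu₀]
        simpa [Pi.single_eq_of_ne hst.ne'] using he
      · rw [hu j hj.le, hu₀]
        simp [Pi.single_eq_of_ne hj.ne', Pi.single_eq_of_ne (hst.trans hj).ne'])
  set C := S.supp.filter fun i => ∀ j, j < t → S.col i j = v j with hC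
  set I := S.supp.filter fun i => (∃ j, j < t ∧ S.col i j ≠ 0) ∧ ∃ j, j < t ∧ S.col i j ≠ v j
    with hI
  set Z := (S.supp ∪ y.support).filter fun i => (∀ j, j < t → S.col i j = 0) ∧
      y i ≠ S.word a i - e * S.col i t with hZ
  have c1 : C.card = 3 * (r * 3 ^ (k - 1 - t)) := by
    have := Finset.card_eq_sum_card_fiberwise (f := fun i => S.col i t) (s := C)
      (t := Finset.univ) (fun i _ => Finset.mem_coe.2 (Finset.mem_univ _))
    rw [this, Finset.sum_congr rfl (g := fun _ => r * 3 ^ (k - 1 - t.val)), Finset.sum_const,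
      Finset.card_univ, ZMod.card, smul_eq_mul]
    intro c _
    rw [← S.card_agree t (Function.update v t c) ⟨s, hst.le, by
      rw [Function.update_of_ne hst.ne, hs1], fun j hj => by
      rw [Function.update_of_ne (hj.trans hst).ne, hs0 j hj]⟩, hC, agree, Finset.filter_filter]
    congr 1
    refine Finset.filter_congr fun i _ => ⟨fun hi j hj => ?_, fun hi => ⟨fun j hj => ?_, ?_⟩⟩
    · rcases hj.lt_or_eq with hj | rfl
      · rw [hi.1 j hj, Function.update_of_ne hj.ne]
      · rw [hi.2, Function.update_self]
    · rw [hi j hj.le, Function.update_of_ne hj.ne]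
    · rw [hi t le_rfl, Function.update_self]
  have c2 : I.card + C.card = (S.pre t).card := by
    rw [← Finset.card_union_of_disjoint]
    · congr 1
      rw [coe_pre]
      ext i
      simp only [hI, hC, Finset.mem_union, Finset.mem_filter, ← and_or_left, and_congr_right_iff]
      intro _
      constructor
      · rintro (hi | hi)
        · exact hi.1
        · exact ⟨s, hst, by rw [hi s hst, hs1]; exact one_ne_zero⟩
      · intro hi
        by_cases hall : ∀ j, j < t → S.col i j = v j
        · exact Or.inr hall
        · push Not at hall
          exact Or.inl ⟨hi, hall⟩
    · rw [Finset.disjoint_left]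
      intro i hi hi'
      obtain ⟨-, j, hj, hne⟩ := (Finset.mem_filter.1 hi).2
      exact hne ((Finset.mem_filter.1 hi').2 j hj)
  have c3 : ((S.supp ∪ y.support).filter fun i => ¬ ((∃ j, j < t ∧ S.col i j ≠ 0) ∧
      ∃ j, j < t ∧ S.col i j ≠ v j) ∧ y i ≠ S.word u₀ i) ⊆
      Z ∪ C.filter fun i => ¬ y i = S.word a i + e * (b - S.col i t) := by
    intro i hi
    obtain ⟨hi1, hi2, hi3⟩ := Finset.mem_filter.1 hi
    rw [hw] at hi3
    by_cases h0 : ∃ j, j < t ∧ S.col i j ≠ 0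
    · have h1 : ∀ j, j < t → S.col i j = v j := by
        intro j hj
        by_contra hc
        exact hi2 ⟨h0, j, hj, hc⟩
      obtain ⟨j, hj, hne⟩ := h0
      refine Finset.mem_union_right _ (Finset.mem_filter.2
        ⟨Finset.mem_filter.2 ⟨S.mem_supp_of_ne hne, h1⟩, fun hc => hi3 ?_⟩)
      rw [hc, h1 s hst, hs1]
      ring
    · push Not at h0
      refine Finset.mem_union_left _ (Finset.mem_filter.2 ⟨hi1, h0, fun hc => hi3 ?_⟩)
      rw [hc, h0 s hst]
      ring
  have c4 := (Finset.card_le_card c3).trans (Finset.card_union_le _ _)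
  have c5 := Finset.card_filter_add_card_filter_not (s := C)
    (fun i => y i = S.word a i + e * (b - S.col i t))
  rw [hC, Finset.filter_filter, ← hC] at c5
  have h6 := S.two_mul_card_pre t.2.le
  rw [mul_left_comm, three_mul_pow t] at hav
  rw [pow_sub_eq t, mul_left_comm] at h6
  omega

end SimplexColumns

/-! ### Forbidden changes at a single column -/

namespace SimplexColumns

variable {k r : ℕ} {S : SimplexColumns k r} {y : FinSeq 3} {a : Fin k → ZMod 3}

theorem agree_of_zero_prefix {t : Fin k} {i : ℕ} (h0 : ∀ j, j < t → S.col i j = 0)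
    (ht : S.col i t ≠ 0) : i ∈ S.agree t (Pi.single t 1) := by
  refine Finset.mem_filter.2 ⟨S.mem_supp_of_ne ht, fun j hj => ?_⟩
  rcases hj.lt_or_eq with hj | rfl
  · rw [h0 j hj, Pi.single_eq_of_ne hj.ne]
  · rw [Pi.single_eq_same, (S.proj_of_ne ht).eq_one h0 ht]

theorem card_agree_single (t : Fin k) :
    (S.agree t (Pi.single t 1)).card = r * 3 ^ (k - 1 - t) :=
  S.card_agree t _ ⟨t, le_rfl, by simp, fun _ hj => Pi.single_eq_of_ne hj.ne _⟩

/-- If `y` agrees with the word `a` on all columns that start with more than `s` zeros, then every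
value occurs at most as often as in the word `a` among the columns with a given start. -/
theorem Far.card_le (h : S.Far y a) {t s : Fin k} {v : Fin k → ZMod 3} {e : ZMod 3}
    (he : (a t - e).val < (a t).val) (hst : s < t) (hs1 : v s = 1) (hs0 : ∀ j, j < s → v j = 0)
    (hag : ∀ i, (∀ j, j ≤ s → S.col i j = 0) → y i = S.word a i) (b : ZMod 3) :
    (S.supp.filter fun i => (∀ j, j < t → S.col i j = v j) ∧
      y i = S.word a i + e * (b - S.col i t)).card ≤ r * 3 ^ (k - 1 - t) := by
  rw [← S.card_agree_single t]
  refine (h.card_le_zero he hst hs1 hs0 b).trans (Finset.card_le_card fun i hi => ?_)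
  obtain ⟨-, h0, hne⟩ := Finset.mem_filter.1 hi
  refine agree_of_zero_prefix h0 fun hc => hne ?_
  rw [hag i fun j hj => h0 j (hj.trans_lt hst), hc, mul_zero, sub_zero]

theorem agree_on_zero_prefix {v : Fin k → ZMod 3} {t s : Fin k} (hst : s < t) (hs1 : v s = 1)
    (hs0 : ∀ j, j < s → v j = 0)
    (hA : ∀ t' i, t' < t → (∀ j, j < t' → S.col i j = v j) → (S.col i t').val < (v t').val →
      y i = S.word a i) (i : ℕ) (hi : ∀ j, j ≤ s → S.col i j = 0) : y i = S.word a i := by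
  refine hA s i hst (fun j hj => by rw [hi j hj.le, hs0 j hj]) ?_
  rw [hi s le_rfl, hs1]
  decide

/-- The columns with prefix `v` and entry `b` at `t` already saturate `Far.card_le`, apart from the
exceptions in `X`; the larger set `Q` would overfill it. If the leading 1 of `v` is at `t` itself,
then `b = 0`, and `Q` instead removes too many of the mismatches demanded by `Far.le_card_zero`. -/
theorem Far.not_shift (h : S.Far y a) {t : Fin k} {v : Fin k → ZMod 3} (hv : IsProjRep v)
    {e b : ZMod 3} (he : (a t - e).val < (a t).val) (hb : b.val < (v t).val)
    (hA : ∀ t' i, t' < t → (∀ j, j < t' → S.col i j = v j) → (S.col i t').val < (v t').val →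
      y i = S.word a i)
    {Q X : Finset ℕ} (hXQ : X.card < Q.card)
    (hX : ∀ i, (∀ j, j < t → S.col i j = v j) → (S.col i t).val < (v t).val →
      y i = S.word a i ∨ i ∈ X)
    (hQ : ∀ i ∈ Q, ∀ j, j ≤ t → S.col i j = v j) :
    ¬ ∀ i ∈ Q, y i = S.word a i + e * (b - v t) := by
  classical
  intro hy
  have hvt : v t ≠ 0 := by
    intro hc
    rw [hc] at hb
    simp at hb
  have hbt : b ≠ v t := by
    rintro rfl
    exact lt_irrefl _ hb
  have hQs : ∀ i ∈ Q, i ∈ S.supp := fun i hi =>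
    S.mem_supp_of_ne (t := t) (by rw [hQ i hi t le_rfl]; exact hvt)
  obtain ⟨s, hs1, hs0⟩ := hv
  have hst : s ≤ t := by
    by_contra hc
    exact hvt (hs0 t (not_le.1 hc))
  rcases hst.lt_or_eq with hst | rfl
  · have h1 := h.card_le he hst hs1 hs0 (agree_on_zero_prefix hst hs1 hs0 hA) b
    rw [← S.card_agree t (Function.update v t b) ⟨s, hst.le, by
      rw [Function.update_of_ne hst.ne, hs1], fun j hj => by
      rw [Function.update_of_ne (hj.trans hst).ne, hs0 j hj]⟩] at h1
    have h2 : (S.agree t (Function.update v t b) \ X) ∪ Q ⊆ S.supp.filter fun i =>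
        (∀ j, j < t → S.col i j = v j) ∧ y i = S.word a i + e * (b - S.col i t) := by
      intro i hi
      rcases Finset.mem_union.1 hi with hi | hi
      · obtain ⟨hi1, hi2⟩ := Finset.mem_sdiff.1 hi
        obtain ⟨hi3, hi4⟩ := Finset.mem_filter.1 hi1
        have hlt : ∀ j, j < t → S.col i j = v j := fun j hj => by
          rw [hi4 j hj.le, Function.update_of_ne hj.ne]
        have ht : S.col i t = b := by rw [hi4 t le_rfl, Function.update_self]
        refine Finset.mem_filter.2 ⟨hi3, hlt, ?_⟩
        rw [ht, sub_self, mul_zero, add_zero]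
        exact (hX i hlt (by rwa [ht])).resolve_right hi2
      · refine Finset.mem_filter.2 ⟨hQs i hi, fun j hj => hQ i hi j hj.le, ?_⟩
        rw [hQ i hi t le_rfl, hy i hi]
    have h3 := Finset.card_le_card h2
    rw [Finset.card_union_of_disjoint] at h3
    · have h4 := Finset.le_card_sdiff X (S.agree t (Function.update v t b))
      omega
    · rw [Finset.disjoint_left]
      intro i hi hi'
      have := (Finset.mem_filter.1 (Finset.mem_sdiff.1 hi).1).2 t le_rfl
      rw [Function.update_self, hQ i hi' t le_rfl] at this
      exact hbt this.symm
  · have h1 := h.le_card_zero he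
    have hb0 : b = 0 := by
      rw [hs1] at hb
      exact (ZMod.val_eq_zero b).1 (Nat.lt_one_iff.1 hb)
    rw [← S.card_agree_single s] at h1
    have h2 : ((S.supp ∪ y.support).filter fun i => (∀ j, j < s → S.col i j = 0) ∧
        y i ≠ S.word a i - e * S.col i s) ⊆ X ∪ (S.agree s (Pi.single s 1) \ Q) := by
      intro i hi
      obtain ⟨-, h0, hne⟩ := Finset.mem_filter.1 hi
      rw [Finset.mem_union]
      by_cases ht : S.col i s = 0
      · left
        refine (hX i (fun j hj => by rw [h0 j hj, hs0 j hj]) (by rw [ht, hs1]; decide)).resolve_left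
          fun hc => hne ?_
        rw [hc, ht, mul_zero, sub_zero]
      · right
        refine Finset.mem_sdiff.2 ⟨agree_of_zero_prefix h0 ht, fun hiQ => hne ?_⟩
        rw [hy i hiQ, hQ i hiQ s le_rfl, hb0]
        ring
    have h3 : Q ⊆ S.agree s (Pi.single s 1) := fun i hi => by
      refine agree_of_zero_prefix (fun j hj => by rw [hQ i hi j hj.le, hs0 j hj]) ?_
      rw [hQ i hi s le_rfl]
      exact hvt
    have h4 := (Finset.card_le_card h2).trans (Finset.card_union_le _ _)
    rw [Finset.card_sdiff_of_subset h3] at h4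
    have h5 := Finset.card_le_card h3
    omega

/-- Let `B` be the columns with prefix `v` and entry 2 at `t` where `y` deviates. `Far.not_shift` at
`t'` excludes a deviation by -1, so it is by 1. Then `Far.card_le` with `b = 0` gives `B.card ≤
X.card`, and with `b = 2` gives `Q.card ≤ B.card`. -/
theorem Far.not_two_ones (h : S.Far y a) {t t' : Fin k} (htt : t' < t) {v : Fin k → ZMod 3}
    (hv : IsProjRep v) (hat : a t = 1) (hvt : v t = 1) (hat' : a t' = 1) (hvt' : v t' = 1)
    (hA : ∀ t' i, t' < t → (∀ j, j < t' → S.col i j = v j) → (S.col i t').val < (v t').val →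
      y i = S.word a i)
    {Q X : Finset ℕ} (hXQ : X.card < Q.card)
    (hX : ∀ i, (∀ j, j < t → S.col i j = v j) → (S.col i t).val < (v t).val →
      y i = S.word a i ∨ i ∈ X)
    (hQ : ∀ i ∈ Q, ∀ j, j ≤ t → S.col i j = v j) :
    ¬ ∀ i ∈ Q, y i = S.word a i + 1 := by
  classical
  intro hy
  obtain ⟨s, hs1, hs0⟩ := id hv
  have hst : s < t := by
    refine lt_of_le_of_lt (not_lt.1 fun hc => ?_) htt
    rw [hs0 t' hc] at hvt'
    simp at hvt'
  have he : ∀ {t : Fin k}, a t = 1 → (a t - 1).val < (a t).val := fun h => by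
    rw [h]
    decide
  have hag := agree_on_zero_prefix hst hs1 hs0 hA
  have hnot : ∀ i, (∀ j, j < t → S.col i j = v j) → y i ≠ S.word a i + 1 * (0 - v t') := by
    intro i hi hc
    refine h.not_shift (t := t') (b := 0) (Q := {i}) (X := ∅) hv (he hat') ?_
      (fun t₁ i h1 => hA t₁ i (h1.trans htt)) (by simp) (fun i h1 h2 => Or.inl (hA t' i htt h1 h2))
      ?_ ?_
    · rw [hvt']
      decide
    · simpa using fun j (hj : j ≤ t') => hi j (hj.trans_lt htt)
    · simpa using hc
  have hcard : ∀ b, (S.agree t (Function.update v t b)).card = r * 3 ^ (k - 1 - t) := fun b =>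
    S.card_agree t (Function.update v t b) ⟨s, hst.le, by
      rw [Function.update_of_ne hst.ne, hs1], fun j hj => by
      rw [Function.update_of_ne (hj.trans hst).ne, hs0 j hj]⟩
  have hmem : ∀ b i, i ∈ S.agree t (Function.update v t b) →
      i ∈ S.supp ∧ (∀ j, j < t → S.col i j = v j) ∧ S.col i t = b := by
    intro b i hi
    obtain ⟨h1, h2⟩ := Finset.mem_filter.1 hi
    exact ⟨h1, fun j hj => by rw [h2 j hj.le, Function.update_of_ne hj.ne], by
      rw [h2 t le_rfl, Function.update_self]⟩
  set B := (S.agree t (Function.update v t 2)).filter fun i => ¬ y i = S.word a i with hB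
  have h0 := h.card_le (he hat) hst hs1 hs0 hag 0
  have h2 := h.card_le (he hat) hst hs1 hs0 hag 2
  have k0 : (S.agree t (Function.update v t 0) \ X) ∪ B ⊆ S.supp.filter fun i =>
      (∀ j, j < t → S.col i j = v j) ∧ y i = S.word a i + 1 * (0 - S.col i t) := by
    intro i hi
    rcases Finset.mem_union.1 hi with hi | hi
    · obtain ⟨hi1, hi2⟩ := Finset.mem_sdiff.1 hi
      obtain ⟨m1, m2, m3⟩ := hmem _ _ hi1
      refine Finset.mem_filter.2 ⟨m1, m2, ?_⟩
      rw [m3, sub_self, mul_zero, add_zero]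
      exact (hX i m2 (by rw [m3, hvt]; decide)).resolve_right hi2
    · obtain ⟨hi1, hi2⟩ := Finset.mem_filter.1 hi
      obtain ⟨m1, m2, m3⟩ := hmem _ _ hi1
      refine Finset.mem_filter.2 ⟨m1, m2, ?_⟩
      have hn := hnot i m2
      rw [hvt'] at hn
      rw [m3]
      generalize y i = p at *
      generalize S.word a i = q at *
      revert p q
      decide
  have k2 : (S.agree t (Function.update v t 2) \ B) ∪ Q ⊆ S.supp.filter fun i =>
      (∀ j, j < t → S.col i j = v j) ∧ y i = S.word a i + 1 * (2 - S.col i t) := by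
    intro i hi
    rcases Finset.mem_union.1 hi with hi | hi
    · obtain ⟨hi1, hi2⟩ := Finset.mem_sdiff.1 hi
      obtain ⟨m1, m2, m3⟩ := hmem _ _ hi1
      refine Finset.mem_filter.2 ⟨m1, m2, ?_⟩
      rw [m3, sub_self, mul_zero, add_zero]
      by_contra hc
      exact hi2 (Finset.mem_filter.2 ⟨hi1, hc⟩)
    · refine Finset.mem_filter.2 ⟨S.mem_supp_of_ne (t := t) ?_, fun j hj => hQ i hi j hj.le, ?_⟩
      · rw [hQ i hi t le_rfl, hvt]
        exact one_ne_zero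
      · rw [hQ i hi t le_rfl, hvt, hy i hi]
        congr 1
  have l0 := Finset.card_le_card k0
  have l2 := Finset.card_le_card k2
  rw [Finset.card_union_of_disjoint] at l0
  · rw [Finset.card_union_of_disjoint] at l2
    · have e0 := Finset.le_card_sdiff X (S.agree t (Function.update v t 0))
      have e2 := Finset.le_card_sdiff B (S.agree t (Function.update v t 2))
      rw [hcard] at e0 e2
      omega
    · rw [Finset.disjoint_left]
      intro i hi hi'
      have m := (hmem _ _ (Finset.mem_sdiff.1 hi).1).2.2
      rw [hQ i hi' t le_rfl, hvt] at m
      exact absurd m (by decide)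
  · rw [Finset.disjoint_left]
    intro i hi hi'
    have m := (hmem _ _ (Finset.mem_sdiff.1 hi).1).2.2
    rw [(hmem _ _ (Finset.mem_filter.1 hi').1).2.2] at m
    exact absurd m (by decide)

/-- The value of `y` at columns equal to `v` cannot improve on that of the word `a`, if `y` agrees
with the word `a` on the columns lexicographically smaller than `v`. -/
theorem Far.not_lt (h : S.Far y a) {v w : Fin k → ZMod 3} (hv : v = 0 ∨ IsProjRep v) {τ : ℕ}
    (hw : ∀ t : Fin k, t.val < τ → (w t).val ≤ (v t).val)
    (hw' : ∀ t : Fin k, τ ≤ t.val → w t = v t) {Q X : Finset ℕ} {δ : ZMod 3}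
    (hA : ∀ t i, t.val + 1 < τ → (∀ j, j < t → S.col i j = v j) → (S.col i t).val < (v t).val →
      y i = S.word a i)
    (hXQ : X.card < Q.card)
    (hX : ∀ t i, t.val < τ → (∀ j, j < t → S.col i j = v j) → (S.col i t).val < (v t).val →
      y i = S.word a i ∨ i ∈ X)
    (hQ : ∀ i ∈ Q, S.col i = v) (hy : ∀ i ∈ Q, y i = S.word a i + δ) :
    ¬ (a ⬝ᵥ v - a ⬝ᵥ w + δ).val < (a ⬝ᵥ v - a ⬝ᵥ w).val := by
  rcases hv with rfl | hv
  · have : w = 0 := by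
      ext t
      rcases lt_or_ge t.val τ with ht | ht
      · have := hw t ht
        simp only [Pi.zero_apply, ZMod.val_zero, nonpos_iff_eq_zero, ZMod.val_eq_zero] at this
        rw [this, Pi.zero_apply]
      · rw [hw' t ht]
    subst this
    simp
  by_cases hδ : δ = 0
  · simp [hδ]
  have hA' : ∀ t : Fin k, t.val < τ → ∀ t' i, t' < t → (∀ j, j < t' → S.col i j = v j) →
      (S.col i t').val < (v t').val → y i = S.word a i := fun t ht t' i htt =>
    hA t' i (by have : t'.val < t.val := htt; omega)
  have hns : ∀ t : Fin k, t.val < τ → ∀ e b : ZMod 3, (a t - e).val < (a t).val →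
      b.val < (v t).val → δ ≠ e * (b - v t) := by
    intro t ht e b he hb hc
    exact h.not_shift hv he hb (hA' t ht) hXQ (fun i => hX t i ht) (fun i hi j _ => by rw [hQ i hi])
      (by rw [← hc]; exact hy)
  have hcase : ∀ t : Fin k, t.val < τ → (a t * (v t - w t) = 0) ∨ (a t = 1 ∧ v t = 1 ∧ δ = 1) := by
    intro t ht
    -- With `p`, `q`, `u` standing for the entries of `a`, `v`, `w` at `t`, only a rise by 1 with `p
    -- = q = 1` escapes `Far.not_shift` when the term is nonzero.
    have key : ∀ δ p q u : ZMod 3, δ ≠ 0 → u.val ≤ q.val →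
        (∀ e b : ZMod 3, (p - e).val < p.val → b.val < q.val → δ ≠ e * (b - q)) →
        p * (q - u) = 0 ∨ (p = 1 ∧ q = 1 ∧ δ = 1) := by
      decide
    exact key δ _ _ _ hδ (hw t ht) (hns t ht)
  have hsum : a ⬝ᵥ v - a ⬝ᵥ w = ∑ t, a t * (v t - w t) := by
    rw [← dotProduct_sub]
    rfl
  by_cases hone : ∃ t : Fin k, t.val < τ ∧ a t = 1 ∧ v t = 1 ∧ δ = 1
  · obtain ⟨t, ht, hat, hvt, rfl⟩ := hone
    have huniq : ∀ t' : Fin k, t' ≠ t → a t' * (v t' - w t') = 0 := by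
      intro t' hne
      rcases lt_or_ge t'.val τ with ht' | ht'
      · refine (hcase t' ht').resolve_right ?_
        rintro ⟨hat', hvt', -⟩
        rcases lt_or_gt_of_ne hne with hlt | hlt
        · exact h.not_two_ones hlt hv hat hvt hat' hvt' (hA' t ht) hXQ (fun i => hX t i ht)
            (fun i hi j _ => by rw [hQ i hi]) hy
        · exact h.not_two_ones hlt hv hat' hvt' hat hvt (hA' t' ht') hXQ (fun i => hX t' i ht')
            (fun i hi j _ => by rw [hQ i hi]) hy
      · rw [hw' t' ht', sub_self, mul_zero]
    rw [hsum, Finset.sum_eq_single t (fun t' _ h => huniq t' h) (by simp), hat, hvt]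
    -- The sum is the single term `1 - w t`, which is 0 or 1 since `w t` is at most 1; adding 1 does
    -- not lower it.
    have h2 := hw t ht
    rw [hvt] at h2
    generalize w t = u at *
    clear * - h2
    revert u
    decide
  · rw [hsum, Finset.sum_eq_zero]
    · simp
    · intro t _
      rcases lt_or_ge t.val τ with ht | ht
      · exact (hcase t ht).resolve_right fun hc => hone ⟨t, ht, hc⟩
      · rw [hw' t ht, sub_self, mul_zero]

end SimplexColumns

/-! ### Lexicographic arrangement of the columns and its permutations -/

/-- `c` is lexicographically smaller than `v`, the first entry being the most significant one. -/
def LexLt {k : ℕ} (c v : Fin k → ZMod 3) : Prop :=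
  ∃ t, (∀ j, j < t → c j = v j) ∧ (c t).val < (v t).val

/-- `g` lists the normalized vectors in lexicographically decreasing order, followed by zeros. -/
structure IsDecreasingEnum {k : ℕ} (P : ℕ) (g : ℕ → Fin k → ZMod 3) : Prop where
  proj : ∀ b, b < P → IsProjRep (g b)
  eq_zero : ∀ b, P ≤ b → g b = 0
  surj : ∀ v, IsProjRep v → ∃ b, b < P ∧ g b = v
  inj : ∀ b c, b < P → c < P → g b = g c → b = c
  lt : ∀ b c, LexLt (g b) (g c) → c < b

theorem exists_isDecreasingEnum (k : ℕ) :
    ∃ (P : ℕ) (g : ℕ → Fin k → ZMod 3), IsDecreasingEnum P g := by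
  classical
  let T := {v : Fin k → ZMod 3 // IsProjRep v}
  let f : T → (Lex (Fin k → ℕ))ᵒᵈ := fun v => OrderDual.toDual (toLex fun i => (v.1 i).val)
  have hf : Function.Injective f := by
    intro v w h
    have h' : (fun i => (v.1 i).val) = fun i => (w.1 i).val := h
    exact Subtype.ext (funext fun i => ZMod.val_injective 3 (congrFun h' i))
  let : LinearOrder T := LinearOrder.lift' f hf
  let e : Fin (Fintype.card T) ≃o T := Fintype.orderIsoFinOfCardEq T rfl
  refine ⟨Fintype.card T, fun b => if h : b < Fintype.card T then (e ⟨b, h⟩).1 else 0, ?_, ?_, ?_,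
    ?_, ?_⟩
  · intro b hb
    simp only [hb, dif_pos]
    exact (e ⟨b, hb⟩).2
  · intro b hb
    simp [hb.not_gt]
  · intro v hv
    refine ⟨(e.symm ⟨v, hv⟩).1, (e.symm ⟨v, hv⟩).2, ?_⟩
    simp
  · intro b c hb hc h
    simp only [hb, hc, dif_pos] at h
    have := e.injective (Subtype.ext h)
    exact congrArg Fin.val this
  · intro b c h
    by_cases hc : c < Fintype.card T
    · by_cases hb : b < Fintype.card T
      · simp only [hb, hc, dif_pos] at h
        obtain ⟨t, ht, hlt⟩ := h
        have h1 : e ⟨c, hc⟩ < e ⟨b, hb⟩ := by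
          change toLex (fun i => ((e ⟨b, hb⟩).1 i).val) < toLex fun i => ((e ⟨c, hc⟩).1 i).val
          exact ⟨t, fun j hj => congrArg ZMod.val (ht j hj), hlt⟩
        exact e.lt_iff_lt.1 h1
      · omega
    · obtain ⟨t, -, hlt⟩ := h
      simp [hc] at hlt

namespace IsDecreasingEnum

variable {k P r : ℕ} {g : ℕ → Fin k → ZMod 3}

theorem zero_or_proj (hg : IsDecreasingEnum P g) (b : ℕ) : g b = 0 ∨ IsProjRep (g b) :=
  (lt_or_ge b P).symm.imp (hg.eq_zero b) (hg.proj b)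

/-- The columns obtained by repeating every column `g b` in `r` consecutive places and permuting
the places by `ρ`. -/
noncomputable def columns (hg : IsDecreasingEnum P g) (hr : 0 < r) (ρ : Equiv.Perm ℕ) :
    SimplexColumns k r where
  col i := g (ρ i / r)
  supp := (Finset.range (P * r)).map ρ.symm.toEmbedding
  mem_supp i := by
    have : g (ρ i / r) ≠ 0 ↔ ρ i / r < P := by
      constructor
      · intro h
        by_contra hc
        exact h (hg.eq_zero _ (not_lt.1 hc))
      · exact fun h => (hg.proj _ h).ne_zero
    rw [this, Nat.div_lt_iff_lt_mul hr]
    simp [Finset.mem_map_equiv]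
  proj i hi := by
    refine hg.proj _ ((Nat.div_lt_iff_lt_mul hr).2 ?_)
    simpa [Finset.mem_map_equiv] using hi
  card_fiber v hv := by
    obtain ⟨b, hb, rfl⟩ := hg.surj v hv
    have : ((Finset.range (P * r)).map ρ.symm.toEmbedding).filter (fun i => g (ρ i / r) = g b) =
        (Finset.Ico (b * r) (b * r + r)).map ρ.symm.toEmbedding := by
      ext i
      simp only [Finset.mem_filter, Finset.mem_map_equiv, Equiv.symm_symm, Finset.mem_range,
        Finset.mem_Ico]
      rw [← Nat.div_lt_iff_lt_mul hr]
      constructor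
      · rintro ⟨h1, h2⟩
        have := hg.inj _ _ h1 hb h2
        rw [Nat.div_eq_iff hr] at this
        omega
      · intro h
        have : ρ i / r = b := by
          rw [Nat.div_eq_iff hr]
          omega
        rw [this]
        exact ⟨hb, rfl⟩
    rw [this, Finset.card_map, Nat.card_Ico]
    omega

theorem lt_of_lexLt (hg : IsDecreasingEnum P g) {i j : ℕ}
    (h : LexLt (g (i / r)) (g (j / r))) : j < i := by
  by_contra hc
  exact absurd (hg.lt _ _ h) (not_lt.2 (Nat.div_le_div_right (not_lt.1 hc)))

/-- The slot of the coordinate `η` if the order at `η` is shifted by the coordinate `ξ`. -/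
theorem exists_slot (hg : IsDecreasingEnum P g) {ξ η : ℕ} (h : η < ξ) :
    ∃ s ≤ η, ∃ τ : ℕ, (∀ t : Fin k, t.val < τ → (g (ξ / r) t).val ≤ (g (s / r) t).val) ∧
      (∀ t : Fin k, τ ≤ t.val → g (ξ / r) t = g (s / r) t) ∧
      ∀ b (t : Fin k), t.val < τ → (∀ j, j < t → g b j = g (s / r) j) →
        (g b t).val < (g (s / r) t).val → η / r < b := by
  rcases Nat.eq_zero_or_pos r with rfl | hr
  -- Division by zero returns 0, so both places carry `g 0`.
  · refine ⟨η, le_rfl, k, fun t _ => by simp, fun t _ => by simp, fun b t _ h1 h2 => ?_⟩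
    exact hg.lt _ _ ⟨t, h1, h2⟩
  by_cases hall : ∀ t, (g (ξ / r) t).val ≤ (g (η / r) t).val
  · exact ⟨η, le_rfl, k, fun t _ => hall t, fun t ht => absurd t.2 (not_lt.2 ht),
      fun b t _ h1 h2 => hg.lt _ _ ⟨t, h1, h2⟩⟩
  · push Not at hall
    -- The cut is the first entry where the column of `ξ` exceeds that of `η`. The new column takes
    -- the prefix of the latter and the tail of the former.
    obtain ⟨t₀, ht₀, hmin⟩ := wellFounded_lt.has_min
      {t | (g (η / r) t).val < (g (ξ / r) t).val} hall
    have hle : ∀ t, t < t₀ → (g (ξ / r) t).val ≤ (g (η / r) t).val := fun t ht =>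
      not_lt.1 fun hc => hmin t hc ht
    -- Otherwise both columns vanish before `t₀`, and the column of `ξ` is lexicographically larger,
    -- contrary to `η < ξ`. A nonzero prefix keeps the spliced column normalized.
    have hne : ∃ t, t < t₀ ∧ g (η / r) t ≠ 0 := by
      by_contra! hc
      refine absurd (hg.lt_of_lexLt (r := r) ⟨t₀, fun j hj => ?_, ht₀⟩) h.not_gt
      have := hle j hj
      rw [hc j hj, ZMod.val_zero, nonpos_iff_eq_zero, ZMod.val_eq_zero] at this
      rw [hc j hj, this]
    obtain ⟨t, ht, hne⟩ := hne
    have hp : IsProjRep (g (η / r)) :=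
      (hg.zero_or_proj (η / r)).resolve_left fun h0 => hne (by simp [h0])
    obtain ⟨s, hs1, hs0⟩ := hp
    have hst : s < t₀ := by
      refine lt_of_le_of_lt (not_lt.1 fun hc => ?_) ht
      exact hne (hs0 t hc)
    obtain ⟨B, hB, hBv⟩ := hg.surj (fun j => if j < t₀ then g (η / r) j else g (ξ / r) j)
      ⟨s, by simp [hst, hs1], fun j hj => by simp [hj.trans hst, hs0 j hj]⟩
    have hlt : ∀ j, j < t₀ → g B j = g (η / r) j := fun j hj => by simp [hBv, hj]
    have hge : ∀ j, t₀ ≤ j → g B j = g (ξ / r) j := fun j hj => by simp [hBv, hj.not_gt]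
    have hBη : B < η / r :=
      hg.lt _ _ ⟨t₀, fun j hj => (hlt j hj).symm, by rw [hge t₀ le_rfl]; exact ht₀⟩
    refine ⟨B * r, ?_, t₀, ?_, ?_, ?_⟩
    · exact (Nat.mul_le_mul_right r hBη.le).trans (Nat.div_mul_le_self η r)
    · intro t ht
      rw [Nat.mul_div_cancel _ hr, hlt t ht]
      exact hle t ht
    · intro t ht
      rw [Nat.mul_div_cancel _ hr, hge t ht]
    · intro b t ht h1 h2
      rw [Nat.mul_div_cancel _ hr] at h1 h2
      refine hg.lt _ _ ⟨t, fun j hj => ?_, ?_⟩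
      · rw [h1 j hj, hlt j (hj.trans ht)]
      · rwa [hlt t ht] at h2

end IsDecreasingEnum

/-- The permutation of `ℕ` that moves `η` to `s` and shifts the numbers in between. -/
def moveDown {s η : ℕ} (h : s ≤ η) : Equiv.Perm ℕ where
  toFun i := if i = η then s else if s ≤ i ∧ i < η then i + 1 else i
  invFun j := if j = s then η else if s < j ∧ j ≤ η then j - 1 else j
  left_inv i := by
    simp only
    split_ifs <;> omega
  right_inv j := by
    simp only
    split_ifs <;> omega

theorem moveDown_apply {s η : ℕ} (h : s ≤ η) (i : ℕ) :
    moveDown h i = if i = η then s else if s ≤ i ∧ i < η then i + 1 else i := rfl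

/-- The permutation of `ℕ` that moves `η` to `ξ`, `ξ` to `ξ - 1`, `ξ - 1` to `ξ + 1`, and shifts the
numbers between `ξ` and `η`. -/
def moveDownSwap {ξ η : ℕ} (h : ξ < η) (h0 : 0 < ξ) : Equiv.Perm ℕ where
  toFun i := if i = η then ξ else if i = ξ then ξ - 1 else if i + 1 = ξ then ξ + 1 else
    if ξ < i ∧ i < η then i + 1 else i
  invFun j := if j = ξ then η else if j + 1 = ξ then ξ else if j = ξ + 1 then ξ - 1 else
    if ξ < j ∧ j ≤ η then j - 1 else j
  left_inv i := by
    simp only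
    split_ifs <;> omega
  right_inv j := by
    simp only
    split_ifs <;> omega

theorem moveDownSwap_apply {ξ η : ℕ} (h : ξ < η) (h0 : 0 < ξ) (i : ℕ) :
    moveDownSwap h h0 i = if i = η then ξ else if i = ξ then ξ - 1 else if i + 1 = ξ then ξ + 1
      else if ξ < i ∧ i < η then i + 1 else i := rfl

/-- An order of the coordinates in which `ξ` and `η` are adjacent and lie in the same block of
length `r`; at most one other coordinate changes its place relative to `ξ`. -/
theorem exists_pairing {r ξ η : ℕ} (hr : 2 ≤ r) (h : ξ < η) :
    ∃ (ρ : Equiv.Perm ℕ) (X : Finset ℕ), X.card ≤ 1 ∧ ρ η / r = ρ ξ / r ∧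
      (∀ i, i < ξ → ρ ξ / r < ρ i / r → i ∈ X ∧ ρ i / r = ρ ξ / r + 1) ∧
      ∀ q i, q ≠ ξ → q ≠ η → ρ q < ρ i → q < i ∧ (i = η → q < ξ) := by
  -- If `ξ` is the last place of its block, `η` takes that place, `ξ` steps back by one, and the
  -- displaced `ξ - 1` opens the next block. Otherwise `ξ + 1` lies in the same block and can
  -- receive `η`.
  by_cases hd : r ∣ ξ + 1
  · obtain ⟨m, hm⟩ := hd
    have hm0 : m ≠ 0 := by
      rintro rfl
      omega
    obtain ⟨m, rfl⟩ := Nat.exists_eq_succ_of_ne_zero hm0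
    rw [Nat.mul_succ, mul_comm] at hm
    have h0 : 0 < ξ := by omega
    have e1 : (ξ - 1) / r = m := by
      rw [Nat.div_eq_iff (by omega)]
      omega
    have e2 : ξ / r = m := by
      rw [Nat.div_eq_iff (by omega)]
      omega
    have e3 : (ξ + 1) / r = m + 1 := by
      rw [Nat.div_eq_iff (by omega), Nat.succ_mul]
      omega
    refine ⟨moveDownSwap h h0, {ξ - 1}, by simp, ?_, ?_, ?_⟩
    · rw [moveDownSwap_apply, moveDownSwap_apply, if_pos rfl, if_neg h.ne, if_pos rfl, e1, e2]
    · intro i hi hlt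
      have e4 : moveDownSwap h h0 ξ = ξ - 1 := by
        rw [moveDownSwap_apply, if_neg h.ne, if_pos rfl]
      have e5 : moveDownSwap h h0 i = if i + 1 = ξ then ξ + 1 else i := by
        rw [moveDownSwap_apply, if_neg (hi.trans h).ne, if_neg hi.ne,
          if_neg (c := ξ < i ∧ i < η) (by omega)]
      rw [e4, e5, e1] at hlt
      rw [e4, e5, e1]
      by_cases hi' : i + 1 = ξ
      · rw [if_pos hi', e3, Finset.mem_singleton]
        exact ⟨by omega, rfl⟩
      · rw [if_neg hi'] at hlt
        have := Nat.div_le_div_right (c := r) (show i ≤ ξ - 1 by omega)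
        omega
    · intro q i h1 h2 h3
      rw [moveDownSwap_apply, moveDownSwap_apply] at h3
      split_ifs at h3 <;> omega
  · refine ⟨moveDown (s := ξ + 1) h, ∅, by simp, ?_, ?_, ?_⟩
    · rw [moveDown_apply, moveDown_apply, if_pos rfl, if_neg h.ne, if_neg (by omega),
        Nat.succ_div_of_not_dvd hd]
    · intro i hi hlt
      rw [moveDown_apply, moveDown_apply, if_neg h.ne, if_neg (by omega), if_neg (by omega),
        if_neg (by omega)] at hlt
      have := Nat.div_le_div_right (c := r) hi.le
      omega
    · intro q i h1 h2 h3
      rw [moveDown_apply, moveDown_apply] at h3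
      split_ifs at h3 <;> omega

/-! ### A greedy arrangement for each basis -/

theorem stdBasis_repr (x : FinSeq 3) (i : ℕ) : (stdBasis 3).repr x i = x i := by
  simp [stdBasis]

theorem twistedBasis_repr {ξ η : ℕ} (h : ξ ≠ η) (x : FinSeq 3) (i : ℕ) :
    (twistedBasis 3 h).repr x i = if i = η then x η - x ξ else x i := by
  have : (twistedBasis 3 h).repr x = (stdBasis 3).repr ((shearEquiv 3 h).symm x) := rfl
  rw [this, stdBasis_repr]
  change (x - Finsupp.single η (x ξ)) i = _
  rw [Finsupp.sub_apply]
  split_ifs with hi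
  · rw [hi, Finsupp.single_eq_same]
  · rw [Finsupp.single_eq_of_ne hi, sub_zero]

namespace SimplexColumns

variable {k r : ℕ} {S : SimplexColumns k r} {y : FinSeq 3} {a : Fin k → ZMod 3}

theorem zero_or_proj (S : SimplexColumns k r) (i : ℕ) : S.col i = 0 ∨ IsProjRep (S.col i) := by
  by_cases h : S.col i = 0
  · exact Or.inl h
  · exact Or.inr (S.proj i ((S.mem_supp i).2 h))

/-- Off a coordinate at which the order is distorted, `y` cannot be smaller than the word `a`. -/
theorem Far.not_lt_of_agree (h : S.Far y a) {q : ℕ}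
    (hag : ∀ i, LexLt (S.col i) (S.col q) → y i = S.word a i) :
    ¬ (y q).val < (S.word a q).val := by
  have := h.not_lt (v := S.col q) (w := 0) (τ := k) (Q := {q}) (X := ∅) (δ := y q - S.word a q)
    (S.zero_or_proj q) (fun t _ => by simp) (fun t ht => absurd t.2 (Nat.not_lt.2 ht))
    (fun t i _ h1 h2 => hag i ⟨t, h1, h2⟩) (by simp)
    (fun t i _ h1 h2 => Or.inl (hag i ⟨t, h1, h2⟩)) (by simp) (by simp)
  have e : a ⬝ᵥ S.col q = S.word a q := rfl
  rw [dotProduct_zero, sub_zero, e, add_sub_cancel] at this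
  exact this

/-- Every word of the code is least among the sequences that are far from the preceding words. -/
def IsGreedy (S : SimplexColumns k r) (F : Module.Basis ℕ (ZMod 3) (FinSeq 3)) : Prop :=
  ∀ a y, S.Far y a → ¬ basisLT F y (S.word a)

end SimplexColumns

namespace IsDecreasingEnum

open SimplexColumns

variable {k P r : ℕ} {g : ℕ → Fin k → ZMod 3}

theorem isGreedy_stdBasis (hg : IsDecreasingEnum P g) (hr : 0 < r) :
    (hg.columns hr (Equiv.refl ℕ)).IsGreedy (stdBasis 3) := by
  rintro a y h ⟨q, hlt, hag⟩
  simp only [stdBasis_repr] at hlt hag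
  exact h.not_lt_of_agree (fun i hi => hag i (hg.lt_of_lexLt hi)) hlt

/-- At a first difference `η`, the value `y ξ` is already that of the word, so `Far.not_lt` applies
with `w` the column of `ξ`. At other places the usual comparison survives, since the move only
lowers `η`. -/
theorem exists_isGreedy_of_gt (hg : IsDecreasingEnum P g) (hr : 0 < r) {ξ η : ℕ} (hlt : η < ξ) :
    ∃ S : SimplexColumns k r, S.IsGreedy (twistedBasis 3 hlt.ne') := by
  obtain ⟨s, hs, τ, hw, hw', hslot⟩ := hg.exists_slot (r := r) hlt
  have hρη : moveDown hs η = s := by rw [moveDown_apply, if_pos rfl]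
  have hρgt : ∀ i, η < i → moveDown hs i = i := fun i hi => by
    rw [moveDown_apply, if_neg hi.ne', if_neg (by omega)]
  refine ⟨hg.columns hr (moveDown hs), ?_⟩
  set S := hg.columns hr (moveDown hs) with hS
  have hcol : ∀ i, S.col i = g (moveDown hs i / r) := fun _ => rfl
  rintro a y h ⟨q, hq, hag⟩
  simp only [twistedBasis_repr] at hq hag
  have hag' : ∀ i, q < i → y i = S.word a i := by
    intro i hi
    have h1 := hag i hi
    split_ifs at h1 with hiη
    · have h2 := hag ξ (by omega)
      rw [if_neg hlt.ne', if_neg hlt.ne'] at h2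
      rw [h2] at h1
      rw [hiη]
      exact sub_left_injective h1
    · exact h1
  by_cases hqη : q = η
  · subst hqη
    rw [if_pos rfl, if_pos rfl, hag' ξ hlt] at hq
    have habove : ∀ (t : Fin k) i, t.val < τ → (∀ j, j < t → S.col i j = S.col q j) →
        (S.col i t).val < (S.col q t).val → y i = S.word a i := by
      intro t i ht h1 h2
      rw [hcol q, hρη] at h1 h2
      have h3 := hslot _ t ht h1 h2
      refine hag' i ?_
      have h4 : q < moveDown hs i := by
        by_contra hc
        exact absurd h3 (not_lt.2 (Nat.div_le_div_right (not_lt.1 hc)))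
      rw [moveDown_apply] at h4
      split_ifs at h4 <;> omega
    have key := h.not_lt (v := S.col q) (w := S.col ξ) (τ := τ) (Q := {q}) (X := ∅)
      (δ := y q - S.word a q) (S.zero_or_proj q)
      (fun t ht => by rw [hcol, hcol, hρη, hρgt ξ hlt]; exact hw t ht)
      (fun t ht => by rw [hcol, hcol, hρη, hρgt ξ hlt]; exact hw' t ht)
      (fun t i ht => habove t i (by omega)) (by simp)
      (fun t i ht h1 h2 => Or.inl (habove t i ht h1 h2)) (by simp) (by simp)
    have e : ∀ i, a ⬝ᵥ S.col i = S.word a i := fun _ => rfl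
    rw [e, e, sub_add_sub_comm, add_comm (S.word a q), ← sub_add_sub_comm, sub_self, add_zero]
      at key
    exact key hq
  · rw [if_neg hqη, if_neg hqη] at hq
    refine h.not_lt_of_agree (fun i hi => hag' i ?_) hq
    have h1 := hg.lt_of_lexLt hi
    rw [moveDown_apply, moveDown_apply] at h1
    split_ifs at h1 <;> omega

theorem exists_isGreedy_of_lt (hg : IsDecreasingEnum P g) (hr : 2 ≤ r) {ξ η : ℕ} (hlt : ξ < η) :
    ∃ S : SimplexColumns k r, S.IsGreedy (twistedBasis 3 hlt.ne) := by
  obtain ⟨ρ, X, hX, hρη, hρξ, hρ⟩ := exists_pairing hr hlt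
  have hr0 : 0 < r := by omega
  refine ⟨hg.columns hr0 ρ, ?_⟩
  set S := hg.columns hr0 ρ with hS
  have hcol : ∀ i, S.col i = g (ρ i / r) := fun _ => rfl
  rintro a y h ⟨q, hq, hag⟩
  have hx : S.word a η - S.word a ξ = 0 := by
    rw [S.word_apply, S.word_apply, hcol, hcol, hρη, sub_self]
  simp only [twistedBasis_repr, hx] at hq hag
  have hag' : ∀ i, q < i → i ≠ η → y i = S.word a i := by
    intro i hi hne
    have h1 := hag i hi
    rwa [if_neg hne, if_neg hne] at h1
  have hη : q < η → y η - y ξ = 0 := by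
    intro hi
    have h1 := hag η hi
    rwa [if_pos rfl, if_pos rfl] at h1
  by_cases hqη : q = η
  · simp [hqη] at hq
  rw [if_neg hqη, if_neg hqη] at hq
  by_cases hqξ : q = ξ
  · subst hqξ
    have hlex : ∀ i, LexLt (S.col i) (S.col q) → ρ q / r < ρ i / r := fun i hi => hg.lt _ _ hi
    have hor : ∀ i, LexLt (S.col i) (S.col q) →
        y i = S.word a i ∨ i ∈ X ∧ ρ i / r = ρ q / r + 1 := by
      intro i hi
      have h1 := hlex i hi
      rcases lt_trichotomy i q with h2 | rfl | h2
      · exact Or.inr (hρξ i h2 h1)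
      · exact absurd h1 (lt_irrefl _)
      · refine Or.inl (hag' i h2 ?_)
        rintro rfl
        omega
    have hne : (Finset.univ.filter fun t => S.col q t ≠ 0).Nonempty := by
      by_contra hc
      rw [Finset.not_nonempty_iff_eq_empty, Finset.filter_eq_empty_iff] at hc
      have : S.word a q = 0 := by
        rw [S.word_apply]
        refine Finset.sum_eq_zero fun j hj => ?_
        rw [not_not.1 (hc hj), mul_zero]
      rw [this] at hq
      simp at hq
    set T := (Finset.univ.filter fun t => S.col q t ≠ 0).max' hne with hT
    have hT0 : S.col q T ≠ 0 := (Finset.mem_filter.1 (Finset.max'_mem _ hne)).2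
    have hgt : ∀ j, T < j → S.col q j = 0 := by
      intro j hj
      by_contra hc
      exact absurd (Finset.le_max' _ j (Finset.mem_filter.2 ⟨Finset.mem_univ _, hc⟩)) (not_le.2 hj)
    -- Clearing the last nonzero entry of the column of `ξ` yields a normalized column strictly
    -- between it and column `i`. Hence column `i` is not in the next block, where the exception
    -- lives.
    have hex : ∀ (t : Fin k) i, t < T → (∀ j, j < t → S.col i j = S.col q j) →
        (S.col i t).val < (S.col q t).val → y i = S.word a i := by
      intro t i ht h1 h2
      refine (hor i ⟨t, h1, h2⟩).resolve_right ?_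
      rintro ⟨-, hi⟩
      obtain ⟨s, hs1, hs0⟩ := S.proj_of_ne hT0
      have hst : s ≤ t := by
        by_contra hc
        rw [hs0 t (not_le.1 hc)] at h2
        simp at h2
      obtain ⟨b, -, hb⟩ := hg.surj (Function.update (S.col q) T 0)
        ⟨s, by rw [Function.update_of_ne (hst.trans_lt ht).ne, hs1], fun j hj => by
          rw [Function.update_of_ne (hj.trans (hst.trans_lt ht)).ne, hs0 j hj]⟩
      have l1 : ρ q / r < b := hg.lt _ _ ⟨T, fun j hj => by
        rw [hb, Function.update_of_ne hj.ne, hcol], by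
        rw [hb, Function.update_self, ← hcol, ZMod.val_zero]
        exact Nat.pos_of_ne_zero fun h0 => hT0 ((ZMod.val_eq_zero _).1 h0)⟩
      have l2 : b < ρ i / r := hg.lt _ _ ⟨t, fun j hj => by
        rw [hb, Function.update_of_ne (hj.trans ht).ne, ← hcol, h1 j hj], by
        rw [hb, Function.update_of_ne ht.ne, ← hcol]
        exact h2⟩
      omega
    have hcη : S.col η = S.col q := by rw [hcol, hcol, hρη]
    -- Agreement of the twisted coordinate at `η` gives `y η = y ξ`, so both places deviate equally
    -- and `Q` has two elements against at most one in `X`.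
    have key := h.not_lt (v := S.col q) (w := 0) (τ := T.val + 1) (Q := {q, η}) (X := X)
      (δ := y q - S.word a q) (S.zero_or_proj q) (fun t _ => by simp)
      (fun t ht => (hgt t (Fin.lt_def.2 (by omega))).symm)
      (fun t i ht => hex t i (Fin.lt_def.2 (by omega)))
      (by rw [Finset.card_pair hlt.ne]; omega)
      (fun t i _ h1 h2 => (hor i ⟨t, h1, h2⟩).imp_right And.left)
      (by
        intro i hi
        rcases Finset.mem_insert.1 hi with rfl | hi
        · rfl
        · rw [Finset.mem_singleton.1 hi, hcη])
      (by
        intro i hi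
        rcases Finset.mem_insert.1 hi with rfl | hi
        · rw [add_sub_cancel]
        · rw [Finset.mem_singleton.1 hi, sub_eq_zero.1 (hη hlt), sub_eq_zero.1 hx, add_sub_cancel])
    have e : a ⬝ᵥ S.col q = S.word a q := rfl
    rw [dotProduct_zero, sub_zero, e, add_sub_cancel] at key
    exact key hq
  · refine h.not_lt_of_agree (fun i hi => ?_) hq
    obtain ⟨h1, h2⟩ := hρ q i hqξ hqη (hg.lt_of_lexLt hi)
    by_cases hiη : i = η
    · subst hiη
      rw [sub_eq_zero.1 (hη h1), hag' ξ (h2 rfl) hlt.ne, sub_eq_zero.1 hx]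
    · exact hag' i h1 hiη

end IsDecreasingEnum

theorem exists_simplexColumns_isGreedy (k : ℕ) {r : ℕ} (hr : 2 ≤ r)
    {F : Module.Basis ℕ (ZMod 3) (FinSeq 3)} (hF : F ∈ basisFamily 3) :
    ∃ S : SimplexColumns k r, S.IsGreedy F := by
  obtain ⟨P, g, hg⟩ := exists_isDecreasingEnum k
  rcases hF with rfl | ⟨ξ, η, h, rfl⟩
  · exact ⟨_, hg.isGreedy_stdBasis (by omega)⟩
  · rcases lt_or_gt_of_ne h with hlt | hlt
    · exact hg.exists_isGreedy_of_lt hr hlt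
    · exact hg.exists_isGreedy_of_gt (by omega) hlt

/-! ### From greediness to the two word sequences -/

/-- The vector of the first `k` ternary digits of `n`. -/
def ternaryDigits (k n : ℕ) : Fin k → ZMod 3 := fun i => ((n / 3 ^ i.val : ℕ) : ZMod 3)

theorem val_ternaryDigits {k : ℕ} (n : ℕ) (i : Fin k) :
    (ternaryDigits k n i).val = n / 3 ^ i.val % 3 := ZMod.val_natCast 3 _

theorem eq_of_ternary_digits {k a b : ℕ} (ha : a < 3 ^ k) (hb : b < 3 ^ k)
    (h : ∀ j, j < k → a / 3 ^ j % 3 = b / 3 ^ j % 3) : a = b := by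
  induction k generalizing a b with
  | zero => simp at ha hb; omega
  | succ k ih =>
    rw [pow_succ] at ha hb
    have h1 := ih (a := a / 3) (b := b / 3) (by omega) (by omega) (fun j hj => by
      rw [Nat.div_div_eq_div_mul, Nat.div_div_eq_div_mul, ← pow_succ']
      exact h (j + 1) (by omega))
    have h2 := h 0 (by omega)
    simp only [pow_zero, Nat.div_one] at h2
    omega

theorem ternaryDigits_injOn (k : ℕ) : Set.InjOn (ternaryDigits k) {a | a < 3 ^ k} := by
  intro a ha b hb h
  refine eq_of_ternary_digits ha hb fun j hj => ?_
  have := congrArg ZMod.val (congrFun h ⟨j, hj⟩)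
  rwa [val_ternaryDigits, val_ternaryDigits] at this

theorem exists_ternaryDigits_eq {k : ℕ} (u : Fin k → ZMod 3) :
    ∃ b, b < 3 ^ k ∧ ternaryDigits k b = u := by
  have hinj : Function.Injective fun a : Fin (3 ^ k) => ternaryDigits k a := fun a b h =>
    Fin.ext (ternaryDigits_injOn k a.2 b.2 h)
  have hb := (Fintype.bijective_iff_injective_and_card _).2 ⟨hinj, by simp [ZMod.card]⟩
  obtain ⟨b, hb⟩ := hb.2 u
  exact ⟨b, b.2, hb⟩

theorem lt_of_ternaryDigits {k a b : ℕ} (ha : a < 3 ^ k) (hb : b < 3 ^ k) {t : Fin k}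
    (ht : (ternaryDigits k b t).val < (ternaryDigits k a t).val)
    (hgt : ∀ j, t < j → ternaryDigits k b j = ternaryDigits k a j) : b < a := by
  by_contra hc
  rw [val_ternaryDigits, val_ternaryDigits] at ht
  have h1 : a / 3 ^ t.val ≤ b / 3 ^ t.val := Nat.div_le_div_right (not_lt.1 hc)
  have hk : 3 ^ k = 3 ^ (k - (t + 1)) * 3 ^ (t.val + 1) := by
    rw [← pow_add]
    congr 1
    omega
  have h2 : a / 3 ^ (t.val + 1) = b / 3 ^ (t.val + 1) := by
    refine eq_of_ternary_digits (k := k - (t + 1)) ?_ ?_ fun j hj => ?_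
    · rwa [Nat.div_lt_iff_lt_mul (by positivity), ← hk]
    · rwa [Nat.div_lt_iff_lt_mul (by positivity), ← hk]
    · rw [Nat.div_div_eq_div_mul, Nat.div_div_eq_div_mul, ← pow_add]
      have := congrArg ZMod.val (hgt ⟨t + 1 + j, by omega⟩ (Fin.lt_def.2 (by simp; omega)))
      rw [val_ternaryDigits, val_ternaryDigits] at this
      exact this.symm
  rw [pow_succ, ← Nat.div_div_eq_div_mul, ← Nat.div_div_eq_div_mul] at h2
  omega

namespace SimplexColumns

variable {k r : ℕ} {S : SimplexColumns k r} {F : Module.Basis ℕ (ZMod 3) (FinSeq 3)}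

/-- If the earlier words of a greedy construction are those of `S`, then so is the next one. -/
theorem IsGreedy.eq_word (hS : S.IsGreedy F) {w : ℕ → FinSeq 3} {n : ℕ} (hn : n < 3 ^ k)
    (hw : ∀ b, b < n → w b = S.word (ternaryDigits k b)) {z : FinSeq 3}
    (hfar : ∀ b, b < n → 3 ^ (k - 1) * r ≤ hdist z (w b))
    (hleast : ∀ x, (∀ b, b < n → 3 ^ (k - 1) * r ≤ hdist x (w b)) → ¬ basisLT F x z) :
    z = S.word (ternaryDigits k n) := by
  by_contra hne
  -- If `z` is smaller, greediness fails; if the codeword is smaller, minimality of `z` fails,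
  -- because the codeword is itself far from the earlier ones.
  rcases basisLT_total F hne with h | h
  · refine hS (ternaryDigits k n) z ?_ h
    rintro u ⟨t, ht, hgt⟩
    obtain ⟨b, hb, rfl⟩ := exists_ternaryDigits_eq u
    have hbn := lt_of_ternaryDigits hn hb ht hgt
    rw [mul_comm, ← hw b hbn]
    exact hfar b hbn
  · refine hleast _ (fun b hb => ?_) h
    rw [mul_comm, hw b hb]
    refine S.le_hdist_word fun hc => hb.ne' (ternaryDigits_injOn k hn (hb.trans hn) hc)

theorem IsGreedy.lexWord_eq (hS : S.IsGreedy F) {n : ℕ} (hn : n < 3 ^ k) :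
    lexWord F (3 ^ (k - 1) * r) n = S.word (ternaryDigits k n) := by
  have : Fact (Nat.Prime 3) := ⟨Nat.prime_three⟩
  induction n using Nat.strong_induction_on with
  | _ n ih =>
    exact hS.eq_word hn (fun b hb => ih b hb (hb.trans hn)) (fun b hb => lexWord_far F _ hb)
      fun x hx => lexWord_least F _ n hx

/-- At powers of 3 the greedy characterization is the same; elsewhere the definition is linear in
the digits, as is `S.word`. -/
theorem IsGreedy.modWord_eq (hS : S.IsGreedy F) {n : ℕ} (hn : n < 3 ^ k) :
    modWord F (3 ^ (k - 1) * r) n = S.word (ternaryDigits k n) := by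
  have : Fact (Nat.Prime 3) := ⟨Nat.prime_three⟩
  induction n using Nat.strong_induction_on with
  | _ n ih =>
    by_cases hpow : ∃ m : ℕ, n = 3 ^ m
    · obtain ⟨m, rfl⟩ := hpow
      exact hS.eq_word hn (fun b hb => ih b hb (hb.trans hn)) (fun b hb => modWord_pow_far F _ m hb)
        fun x hx => modWord_pow_least F _ m hx
    · rw [modWord_of_not_pow F _ hpow hn.le, Finset.sum_range]
      have hsum : ternaryDigits k n = ∑ i : Fin k, (n / 3 ^ i.val % 3) • Pi.single i 1 := by
        ext j
        rw [Finset.sum_apply, Finset.sum_eq_single j]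
        · simp [ternaryDigits]
        · intro i _ hi
          simp [Pi.single_eq_of_ne hi.symm]
        · simp
      rw [hsum, map_sum]
      refine Finset.sum_congr rfl fun i _ => ?_
      rw [map_nsmul]
      by_cases hi : 3 ^ i.val < n
      · rw [ih _ hi (hi.trans hn)]
        congr 2
        ext j
        have hj : ∀ l m : ℕ, ((3 ^ l / 3 ^ m : ℕ) : ZMod 3) = if m = l then 1 else 0 := by
          intro l m
          rcases lt_trichotomy m l with h | rfl | h
          · rw [if_neg h.ne, Nat.pow_div h.le (by norm_num), Nat.cast_pow,
              show ((3 : ℕ) : ZMod 3) = 0 from rfl, zero_pow (by omega)]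
          · rw [if_pos rfl, Nat.div_self (by positivity), Nat.cast_one]
          · rw [if_neg h.ne', Nat.div_eq_of_lt (Nat.pow_lt_pow_right (by norm_num) h),
              Nat.cast_zero]
        rw [ternaryDigits, hj, Pi.single_apply]
        simp only [Fin.ext_iff]
      · have : n < 3 ^ i.val := lt_of_le_of_ne (Nat.not_lt.1 hi) fun h => hpow ⟨_, h⟩
        rw [Nat.div_eq_of_lt this, Nat.zero_mod, zero_smul, zero_smul]

/-! ### The resulting code as a repeated simplex code -/

theorem image_word (S : SimplexColumns k r) {w : ℕ → FinSeq 3}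
    (hw : ∀ n, n < 3 ^ k → w n = S.word (ternaryDigits k n)) :
    w '' {a | a < 3 ^ k} = Set.range S.word := by
  ext x
  constructor
  · rintro ⟨n, hn, rfl⟩
    exact ⟨_, (hw n hn).symm⟩
  · rintro ⟨u, rfl⟩
    obtain ⟨b, hb, rfl⟩ := exists_ternaryDigits_eq u
    exact ⟨b, hb, hw b hb⟩

theorem word_injective (S : SimplexColumns k r) (hr : 0 < r) : Function.Injective S.word := by
  intro a b h
  by_contra hne
  have h1 := S.le_hdist_word hne
  have h2 : 0 < r * 3 ^ (k - 1) := by positivity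
  have h3 : hdist (S.word b) (S.word b) = 0 := by
    simp [hdist, Finsupp.neLocus_eq_empty]
  rw [h, h3] at h1
  omega

theorem mem_codeSupport (S : SimplexColumns k r) (i : ℕ) :
    i ∈ codeSupport (Set.range S.word) ↔ i ∈ S.supp := by
  constructor
  · rintro ⟨_, ⟨a, rfl⟩, h⟩
    exact S.support_word a (Finsupp.mem_support_iff.2 h)
  · intro h
    obtain ⟨t, ht⟩ := Function.ne_iff.1 ((S.mem_supp i).1 h)
    refine ⟨_, ⟨Pi.single t 1, rfl⟩, ?_⟩
    rw [word_single, one_mul]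
    exact ht

theorem exists_equiv_projRep (S : SimplexColumns k r) :
    ∃ e : codeSupport (Set.range S.word) ≃ ProjRep 3 k × Fin r, ∀ i, (e i).1.1 = S.col i := by
  let f : S.supp → ProjRep 3 k := fun i => ⟨S.col i, S.proj i i.2⟩
  have hfib : ∀ v, Nonempty ({i // f i = v} ≃ Fin r) := by
    intro v
    refine ⟨Equiv.trans ?_ (Finset.equivFinOfCardEq (S.card_fiber v.1 v.2))⟩
    refine (Equiv.subtypeEquivRight fun i => ?_).trans
      ((Equiv.subtypeSubtypeEquivSubtypeInter (fun i => i ∈ S.supp) fun i => S.col i = v.1).trans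
        (Equiv.subtypeEquivRight fun i => ?_))
    · exact Subtype.ext_iff
    · rw [Finset.mem_filter]
  let e₀ : codeSupport (Set.range S.word) ≃ S.supp := Equiv.subtypeEquivRight S.mem_codeSupport
  refine ⟨e₀.trans ((Equiv.sigmaFiberEquiv f).symm.trans
    ((Equiv.sigmaCongrRight fun v => (hfib v).some).trans (Equiv.sigmaEquivProd _ _))),
    fun i => rfl⟩

theorem isRepetitionOf (S : SimplexColumns k r) :
    IsRepetitionOf r (codeRes (Set.range S.word)) (simplexCode 3 k) := by
  obtain ⟨e, he⟩ := S.exists_equiv_projRep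
  refine ⟨e, ?_⟩
  rw [codeRes, simplexCode, ← Set.range_comp, ← Set.range_comp]
  congr 1
  ext a i
  simp only [Function.comp_apply, he, word_apply]

end SimplexColumns

theorem theorem5p15 (k d' : ℕ) (hk : 1 ≤ k) (hd' : 2 ≤ d')
    (F : Module.Basis ℕ (ZMod 3) (FinSeq 3)) (hF : F ∈ basisFamily 3) :
    (lexCode F (3 ^ (k - 1) * d') k).ncard = 3 ^ k ∧
    IsLinearCode (lexCode F (3 ^ (k - 1) * d') k) ∧
    lexCode F (3 ^ (k - 1) * d') k = modCode F (3 ^ (k - 1) * d') k ∧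
    IsRepetitionOf d' (codeRes (lexCode F (3 ^ (k - 1) * d') k)) (simplexCode 3 k) := by
  obtain ⟨S, hS⟩ := exists_simplexColumns_isGreedy k hd' hF
  have h1 : lexCode F (3 ^ (k - 1) * d') k = Set.range S.word :=
    S.image_word fun n hn => hS.lexWord_eq hn
  have h2 : modCode F (3 ^ (k - 1) * d') k = Set.range S.word :=
    S.image_word fun n hn => hS.modWord_eq hn
  rw [h1, h2]
  refine ⟨?_, ⟨LinearMap.range S.word, LinearMap.coe_range _⟩, rfl, S.isRepetitionOf⟩
  rw [← Set.image_univ, Set.ncard_image_of_injective _ (S.word_injective (by omega)),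
    Set.ncard_univ, Nat.card_eq_fintype_card]
  simp [ZMod.card]
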